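/- An instance $(G,L,w)$ of the Weighted List Coloring Problem (WLCP) consists of a finite simple graph $G=(V,E)$, a finite set $\mathcal C$ of colors, a list $L(v)\subseteq\mathcal C$ for every $v\in V$, and weights $w\in\mathbb Z_{\ge 0}^{\mathcal C}$. A list coloring of $(G,L)$ is a function $f:V\to\mathcal C$ with $f(v)\in L(v)$ for all $v\in V$ and $f(u)\ne f(v)$ for every edge $uv\in E$; its weight is $w(f)=\sum_{j\in f(V)}w_j$, the sum of the weights of the colors that are used. The task is to output a list coloring of minimum weight, or to answer that no list coloring exists. For $j\in\mathcal C$ let $V_j=\{v\in V: j\in L(v)\}$, and let the color graph $G_j=G[V_j]$ be the subgraph of $G$ induced by $V_j$. Proposition. The WLCP is polynomial-time solvable on instances $(G,L,w)$ such that $G_j$ is a complete graph for all $j\in\mathcal C$. That is, there are a random access machine program (with addition, subtraction and indirect addressing) and a polynomial $p$ such that, on every such instance, given by $|V|$, $|\mathcal C|$, the adjacency matrix of $G$, the vertex-color incidence matrix of the lists and the weights, the program halts with a correct answer, at total logarithmic cost at most $p(N)$, where $N$ is the total binary length of the input. -/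

import Mathlib

/-! ### Random access machines with logarithmic cost

Registers `R 0, R 1, R 2, …` hold natural numbers; there is a read-only input tape of natural
numbers, read from left to right, and a write-only output tape. The instruction set is the classical
one (constants, addition, subtraction, indirect load and store, read, print); control flow
is structured (sequencing, conditional, while loop on `R i > 0`). -/

namespace RAM

/-- The state: register contents, the unread part of the input, and the output printed so far. -/
structure State where
  reg : ℕ → ℕ
  inp : List ℕ
  out : List ℕ

/-- Elementary instructions; the arguments `i j k c` are literals in the program text. -/
inductive Instr where
  /-- `R i := c` -/
  | const (i c : ℕ)
  /-- `R i := R j + R k` -/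
  | add (i j k : ℕ)
  /-- `R i := R j - R k` (which is `0` if `R j < R k`) -/
  | sub (i j k : ℕ)
  /-- `R i := R (R j)` -/
  | load (i j : ℕ)
  /-- `R (R i) := R j` -/
  | store (i j : ℕ)
  /-- Read the next input number into `R i` (`0` if the input is exhausted). -/
  | read (i : ℕ)
  /-- Append `R j` to the output. -/
  | print (j : ℕ)

/-- Programs. -/
inductive Prog where
  | skip
  | instr (a : Instr)
  | seq (p q : Prog)
  /-- If `R i > 0` then `p` else `q`. -/
  | ifPos (i : ℕ) (p q : Prog)
  /-- While `R i > 0` do `p`. -/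
  | whilePos (i : ℕ) (p : Prog)

/-- The logarithmic cost of a number: its binary length plus one. -/
def len (x : ℕ) : ℕ := Nat.size x + 1

/-- The effect of an elementary instruction. -/
def Instr.effect (s : State) : Instr → State
  | .const i c => { s with reg := Function.update s.reg i c }
  | .add i j k => { s with reg := Function.update s.reg i (s.reg j + s.reg k) }
  | .sub i j k => { s with reg := Function.update s.reg i (s.reg j - s.reg k) }
  | .load i j => { s with reg := Function.update s.reg i (s.reg (s.reg j)) }
  | .store i j => { s with reg := Function.update s.reg (s.reg i) (s.reg j) }
  | .read i => { s with reg := Function.update s.reg i (s.inp.headD 0), inp := s.inp.tail }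
  | .print j => { s with out := s.out ++ [s.reg j] }

/-- The logarithmic cost of an elementary instruction: the total length of the numbers
handled, including the addresses that are computed at run time. -/
def Instr.cost (s : State) : Instr → ℕ
  | .const _ c => len c
  | .add _ j k => len (s.reg j) + len (s.reg k)
  | .sub _ j k => len (s.reg j) + len (s.reg k)
  | .load _ j => len (s.reg j) + len (s.reg (s.reg j))
  | .store i j => len (s.reg i) + len (s.reg j)
  | .read _ => len (s.inp.headD 0)
  | .print j => len (s.reg j)

/-- `Exec p s t s'`: started in state `s`, the program `p` halts in state `s'` after a
computation of total logarithmic cost `t`. The rules are deterministic; a computation that does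
not halt has no derivation. -/
inductive Exec : Prog → State → ℕ → State → Prop where
  | skip (s : State) : Exec .skip s 1 s
  | instr (a : Instr) (s : State) : Exec (.instr a) s (a.cost s) (a.effect s)
  | seq {p q : Prog} {s s₁ s₂ : State} {t₁ t₂ : ℕ} :
      Exec p s t₁ s₁ → Exec q s₁ t₂ s₂ → Exec (.seq p q) s (t₁ + t₂) s₂
  | ifTrue {i : ℕ} {p q : Prog} {s s₁ : State} {t : ℕ} :
      0 < s.reg i → Exec p s t s₁ → Exec (.ifPos i p q) s (len (s.reg i) + t) s₁
  | ifFalse {i : ℕ} {p q : Prog} {s s₁ : State} {t : ℕ} :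
      s.reg i = 0 → Exec q s t s₁ → Exec (.ifPos i p q) s (len (s.reg i) + t) s₁
  | whileTrue {i : ℕ} {p : Prog} {s s₁ s₂ : State} {t₁ t₂ : ℕ} :
      0 < s.reg i → Exec p s t₁ s₁ → Exec (.whilePos i p) s₁ t₂ s₂ →
      Exec (.whilePos i p) s (len (s.reg i) + t₁ + t₂) s₂
  | whileFalse {i : ℕ} {p : Prog} {s : State} :
      s.reg i = 0 → Exec (.whilePos i p) s (len (s.reg i)) s

/-- The initial state on input `x`: all registers are `0` and nothing has been printed. -/
def init (x : List ℕ) : State := ⟨fun _ => 0, x, []⟩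

/-- The size of an input: its total binary length. -/
def inputSize (x : List ℕ) : ℕ := (x.map len).sum

/-- A search problem, with instances in `α` encoded by `encode` and with correct answers
described by `IsAnswer`, is *polynomial-time solvable on the instances in `S`*: a single program
halts on every instance in `S` with a correct answer, at a cost that is bounded by a
fixed polynomial in the size of the encoded instance. -/
def PolyTimeSolvableOn {α : Type*} (encode : α → List ℕ) (IsAnswer : α → List ℕ → Prop)
    (S : Set α) : Prop :=
  ∃ (P : Prog) (b : Polynomial ℕ), ∀ a ∈ S, ∃ (t : ℕ) (s : State),
    Exec P (init (encode a)) t s ∧ t ≤ b.eval (inputSize (encode a)) ∧ IsAnswer a s.out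

end RAM

/-! ### The weighted list coloring problem -/

/-- An instance `(G, L, w)` of the weighted list coloring problem: the vertices are numbered
`0, …, n - 1` and the colors are numbered `0, …, m - 1`. -/
structure WLCP where
  /-- the number of vertices -/
  n : ℕ
  /-- the number of colors -/
  m : ℕ
  /-- the graph -/
  G : SimpleGraph (Fin n)
  /-- the lists of colors -/
  L : Fin n → Finset (Fin m)
  /-- the weights of the colors -/
  w : Fin m → ℕ

namespace WLCP

/-- `f` is a list coloring of `(G, L)`. -/
def IsListColoring (I : WLCP) (f : Fin I.n → Fin I.m) : Prop :=
  (∀ u v, I.G.Adj u v → f u ≠ f v) ∧ ∀ v, f v ∈ I.L v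

/-- The active colors of `f`: those assigned to some vertex. -/
def activeColors (I : WLCP) (f : Fin I.n → Fin I.m) : Finset (Fin I.m) :=
  Finset.univ.image f

/-- The weight of a coloring: the sum of the weights of its active colors. -/
def weight (I : WLCP) (f : Fin I.n → Fin I.m) : ℕ :=
  ∑ j ∈ I.activeColors f, I.w j

/-- `f` is a list coloring of minimum weight. -/
def IsOptimal (I : WLCP) (f : Fin I.n → Fin I.m) : Prop :=
  I.IsListColoring f ∧ ∀ g, I.IsListColoring g → I.weight f ≤ I.weight g

/-- The vertices whose lists contain the color `j`. -/
def colorVertexSet (I : WLCP) (j : Fin I.m) : Set (Fin I.n) := {v | j ∈ I.L v}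

/-- The color graph of `j`: the subgraph of `G` induced by the vertices whose lists contain `j`. -/
def colorGraph (I : WLCP) (j : Fin I.m) : SimpleGraph (I.colorVertexSet j) :=
  I.G.induce (I.colorVertexSet j)

open Classical in
/-- The input that describes an instance: `n`, `m`, the adjacency matrix of the graph, the
vertex-color incidence matrix of the lists (both row by row), and the weights. -/
noncomputable def encode (I : WLCP) : List ℕ :=
  [I.n, I.m]
    ++ (List.finRange I.n).flatMap
        (fun u => (List.finRange I.n).map (fun v => if I.G.Adj u v then 1 else 0))
    ++ (List.finRange I.n).flatMap
        (fun v => (List.finRange I.m).map (fun j => if j ∈ I.L v then 1 else 0))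
    ++ (List.finRange I.m).map I.w

/-- The correct answers: `0` if there is no list coloring, and otherwise `1` followed
by the colors `f 0, …, f (n - 1)` of some list coloring `f` of minimum weight. -/
def IsAnswer (I : WLCP) (y : List ℕ) : Prop :=
  ((¬ ∃ f, I.IsListColoring f) ∧ y = [0]) ∨
    ∃ f, I.IsOptimal f ∧ y = 1 :: List.ofFn (fun v => (f v : ℕ))

end WLCP

/-!
If all color graphs are complete, the vertices whose lists contain a given color are pairwise
adjacent, so list colorings are injective: a list coloring is a matching of all the vertices in the
bipartite graph of vertices and colors, and its weight is the sum of the weights of the matched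
colors. The matchable sets of colors are the independent sets of a transversal matroid, so the
greedy algorithm, which inspects the colors by increasing weight, finds a matchable set that is both
of maximal size and, among the sets of that size, of least weight.

Whether a color can be added to a matched set is decided by an auction. The bidders are the colors,
exactly one of which holds no item at a time; the items are the `n` vertices, at initial price `0`,
and a reserve item, which every color accepts, at price `n + 1`. The color without an item takes a
cheapest acceptable one from its owner and raises its price by one, so no owner can ever save more
than one by changing to another item. If the last item to be sold is a vertex, the owners form a
matching. If it is the reserve item, some price in `1, …, n + 1` does not occur among the vertices,
and the owners of the items above this price have too few neighbors for Hall's condition. All prices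
stay below `n + 3`, so one of these happens after polynomially many bids.

The program is written in a language of bounded loops whose only arithmetic operation is the
successor. Hence no value exceeds the largest input number by more than a polynomial in the loop
bounds, and the compiled program handles polynomially many numbers of polynomial binary length.
-/
/-! ### Loop programs -/

namespace RAM

universe u₁ u₂ u₃

/-- The state of a loop program with scalar variables `V` and arrays `K`. -/
structure Store (V : Type u₁) (K : Type u₂) where
  var : V → ℕ
  arr : K → ℕ → ℕ
  inp : List ℕ
  out : List ℕ

/-- Elementary operations of loop programs; `B` names the loop bounds, which are read-only. The
only arithmetic operation is the successor, so that values grow polynomially in the bounds. -/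
inductive Op (V : Type u₁) (K : Type u₂) (B : Type u₃) where
  /-- `x := c` -/
  | const (x : V) (c : ℕ)
  /-- `x := b` -/
  | bound (x : V) (b : B)
  /-- `x := y + 1` -/
  | inc (x y : V)
  /-- `x := y` -/
  | copy (x y : V)
  /-- `x := k[y]` -/
  | get (x : V) (k : K) (y : V)
  /-- `k[y] := x` -/
  | set (k : K) (y x : V)
  /-- Read the next input number into `x`. -/
  | read (x : V)
  /-- Append `x` to the output. -/
  | print (x : V)

/-- Programs all of whose loops have bounds that are fixed in advance. -/
inductive LoopProg (V : Type u₁) (K : Type u₂) (B : Type u₃) where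
  | skip
  | op (o : Op V K B)
  | seq (p q : LoopProg V K B)
  /-- If `x < y` then `p` else `q`. -/
  | ifLt (x y : V) (p q : LoopProg V K B)
  /-- Run `p` for `i = 0, …, b - 1`. -/
  | loop (i : V) (b : B) (p : LoopProg V K B)

/-- What an operation may overwrite. -/
inductive Loc (V : Type u₁) (K : Type u₂) where
  | var (x : V)
  | arr (k : K)
  | out
  deriving DecidableEq

variable {V : Type u₁} {K : Type u₂} {B : Type u₃}

/-- The unique location that an elementary operation overwrites. -/
def Op.target : Op V K B → Loc V K
  | .const x _ | .bound x _ | .inc x _ | .copy x _ | .get x _ _ | .read x => .var x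
  | .set k _ _ => .arr k
  | .print _ => .out

/-- The locations that a loop program may overwrite. -/
def LoopProg.writes : LoopProg V K B → List (Loc V K)
  | .skip => []
  | .op o => [o.target]
  | .seq p q | .ifLt _ _ p q => p.writes ++ q.writes
  | .loop i _ p => .var i :: p.writes

/-- Sequential composition of a list of loop programs. -/
def LoopProg.chain : List (LoopProg V K B) → LoopProg V K B
  | [] => .skip
  | p :: l => .seq p (chain l)

/-- Assignment of a variable. -/
def Store.setVar [DecidableEq V] (e : Store V K) (x : V) (n : ℕ) : Store V K :=
  { e with var := Function.update e.var x n }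

/-- Assignment of an array entry. -/
def Store.setArr [DecidableEq K] (e : Store V K) (k : K) (i n : ℕ) : Store V K :=
  { e with arr := Function.update e.arr k (Function.update (e.arr k) i n) }

/-- The store at the start of a loop program on input `x`. -/
def Store.init (x : List ℕ) : Store V K := ⟨fun _ => 0, fun _ _ => 0, x, []⟩

namespace Store

section

variable [DecidableEq V]

@[simp] theorem setVar_var (e : Store V K) (x : V) (n : ℕ) (y : V) :
    (e.setVar x n).var y = if y = x then n else e.var y := Function.update_apply ..

@[simp] theorem setVar_arr (e : Store V K) (x : V) (n : ℕ) : (e.setVar x n).arr = e.arr := rfl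

@[simp] theorem setVar_inp (e : Store V K) (x : V) (n : ℕ) : (e.setVar x n).inp = e.inp := rfl

@[simp] theorem setVar_out (e : Store V K) (x : V) (n : ℕ) : (e.setVar x n).out = e.out := rfl

end

section

variable [DecidableEq K]

@[simp] theorem setArr_var (e : Store V K) (k : K) (i n : ℕ) : (e.setArr k i n).var = e.var := rfl

@[simp] theorem setArr_arr (e : Store V K) (k : K) (i n : ℕ) (l : K) :
    (e.setArr k i n).arr l = if l = k then Function.update (e.arr k) i n else e.arr l :=
  Function.update_apply ..

@[simp] theorem setArr_inp (e : Store V K) (k : K) (i n : ℕ) : (e.setArr k i n).inp = e.inp := rfl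

end

/-- The stores `e` and `e'` agree outside `W`; nothing is said about the input. -/
structure EqOff (W : List (Loc V K)) (e e' : Store V K) : Prop where
  var : ∀ x, .var x ∉ W → e.var x = e'.var x
  arr : ∀ k, .arr k ∉ W → e.arr k = e'.arr k
  out : .out ∉ W → e.out = e'.out

namespace EqOff

variable {W W' : List (Loc V K)} {e e' e'' : Store V K}

theorem refl (W : List (Loc V K)) (e : Store V K) : e.EqOff W e :=
  ⟨fun _ _ => rfl, fun _ _ => rfl, fun _ => rfl⟩

theorem trans (h : e.EqOff W e') (h' : e'.EqOff W e'') : e.EqOff W e'' :=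
  ⟨fun x hx => (h.var x hx).trans (h'.var x hx), fun k hk => (h.arr k hk).trans (h'.arr k hk),
    fun ho => (h.out ho).trans (h'.out ho)⟩

theorem mono (h : e.EqOff W e') (hW : W ⊆ W') : e.EqOff W' e' :=
  ⟨fun x hx => h.var x (mt (@hW _) hx), fun k hk => h.arr k (mt (@hW _) hk),
    fun ho => h.out (mt (@hW _) ho)⟩

theorem setVar [DecidableEq V] (e : Store V K) {x : V} (n : ℕ) (hx : .var x ∈ W) :
    (e.setVar x n).EqOff W e where
  var y hy := by
    rw [setVar_var, if_neg]
    rintro rfl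
    exact hy hx
  arr _ _ := rfl
  out _ := rfl

end EqOff

/-- All values in the variables, arrays and unread input are at most `M`. -/
structure Bounded (M : ℕ) (e : Store V K) : Prop where
  var : ∀ x, e.var x ≤ M
  arr : ∀ k i, e.arr k i ≤ M
  inp : ∀ a ∈ e.inp, a ≤ M

namespace Bounded

variable {M M' : ℕ} {e : Store V K}

theorem mono (h : e.Bounded M) (hM : M ≤ M') : e.Bounded M' :=
  ⟨fun x => (h.var x).trans hM, fun k i => (h.arr k i).trans hM, fun a ha => (h.inp a ha).trans hM⟩

theorem setVar [DecidableEq V] (h : e.Bounded M) {n : ℕ} (x : V) (hn : n ≤ M) :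
    (e.setVar x n).Bounded M := by
  refine ⟨fun y => ?_, h.arr, h.inp⟩
  rw [setVar_var]
  split_ifs
  exacts [hn, h.var y]

theorem setArr [DecidableEq K] (h : e.Bounded M) {n : ℕ} (k : K) (i : ℕ) (hn : n ≤ M) :
    (e.setArr k i n).Bounded M := by
  refine ⟨h.var, fun l j => ?_, h.inp⟩
  rw [setArr_arr]
  split_ifs
  · rw [Function.update_apply]
    split_ifs
    exacts [hn, h.arr k j]
  · exact h.arr l j

theorem inp_headD (h : e.Bounded M) : e.inp.headD 0 ≤ M := by
  rcases hl : e.inp with - | ⟨a, l⟩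
  · exact Nat.zero_le M
  · exact h.inp a (by simp [hl])

end Bounded

end Store

theorem foldl_range_induction {σ : Type*} {f : σ → ℕ → σ} {s : σ} {n : ℕ} (I : ℕ → σ → Prop)
    (zero : I 0 s) (succ : ∀ k s', k < n → I k s' → I (k + 1) (f s' k)) :
    I n ((List.range n).foldl f s) := by
  induction n with
  | zero => exact zero
  | succ n ih =>
    rw [List.range_succ, List.foldl_append]
    exact succ n _ n.lt_succ_self (ih fun k s' hk => succ k s' (hk.trans n.lt_succ_self))

section Semantics

variable [DecidableEq V] [DecidableEq K]

/-- The effect of an elementary operation if the bounds are `β`. -/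
def Op.run (β : B → ℕ) (e : Store V K) : Op V K B → Store V K
  | .const x c => e.setVar x c
  | .bound x b => e.setVar x (β b)
  | .inc x y => e.setVar x (e.var y + 1)
  | .copy x y => e.setVar x (e.var y)
  | .get x k y => e.setVar x (e.arr k (e.var y))
  | .set k y x => e.setArr k (e.var y) (e.var x)
  | .read x => { e.setVar x (e.inp.headD 0) with inp := e.inp.tail }
  | .print x => { e with out := e.out ++ [e.var x] }

/-- The effect of a loop program if the bounds are `β`. -/
def LoopProg.run (β : B → ℕ) : LoopProg V K B → Store V K → Store V K
  | .skip, e => e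
  | .op o, e => o.run β e
  | .seq p q, e => q.run β (p.run β e)
  | .ifLt x y p q, e => if e.var x < e.var y then p.run β e else q.run β e
  | .loop i b p, e => (List.range (β b)).foldl (fun e' k => p.run β (e'.setVar i k)) e

variable (β : B → ℕ)

theorem Op.run_eqOff (o : Op V K B) (e : Store V K) : (o.run β e).EqOff [o.target] e := by
  cases o with
  | set k y x =>
    refine ⟨fun _ _ => rfl, fun l hl => ?_, fun _ => rfl⟩
    rw [Op.run, Store.setArr_arr, if_neg fun h => hl (by simp [Op.target, h])]
  | print x =>
    exact ⟨fun _ _ => rfl, fun _ _ => rfl, fun h => absurd (List.mem_singleton_self _) h⟩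
  | read x => exact { Store.EqOff.setVar e (e.inp.headD 0) (List.mem_singleton_self _) with }
  | _ => exact Store.EqOff.setVar e _ (List.mem_singleton_self _)

namespace LoopProg

theorem run_eqOff (p : LoopProg V K B) (e : Store V K) : (p.run β e).EqOff p.writes e := by
  induction p generalizing e with
  | skip => exact .refl _ _
  | op o => exact o.run_eqOff β e
  | seq p q hp hq =>
    exact ((hq _).mono (List.subset_append_right _ _)).trans
      ((hp e).mono (List.subset_append_left _ _))
  | ifLt x y p q hp hq =>
    rw [run]
    split_ifs
    exacts [(hp e).mono (List.subset_append_left _ _), (hq e).mono (List.subset_append_right _ _)]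
  | loop i b p hp =>
    refine foldl_range_induction (fun _ (e' : Store V K) => e'.EqOff (loop i b p).writes e)
      (.refl _ _) fun k e' _ he' => ?_
    exact ((hp _).mono (List.subset_cons_self _ _)).trans
      ((Store.EqOff.setVar e' k List.mem_cons_self).trans he')

theorem run_loop_induction {i : V} {b : B} {p : LoopProg V K B} {e : Store V K}
    (I : ℕ → Store V K → Prop) (zero : I 0 e)
    (succ : ∀ k e', k < β b → e'.EqOff (loop i b p).writes e → I k e' →
      I (k + 1) (p.run β (e'.setVar i k))) :
    I (β b) ((loop i b p).run β e) := by
  refine (foldl_range_induction (fun k (e' : Store V K) => e'.EqOff (loop i b p).writes e ∧ I k e')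
    ⟨.refl _ _, zero⟩ fun k e' hk ⟨he', hI⟩ => ⟨?_, succ k e' hk he' hI⟩).2
  exact ((run_eqOff β p _).mono (List.subset_cons_self _ _)).trans
    ((Store.EqOff.setVar e' k List.mem_cons_self).trans he')

@[simp] theorem run_skip (e : Store V K) : (skip : LoopProg V K B).run β e = e := rfl

@[simp] theorem run_op (o : Op V K B) (e : Store V K) : (op o).run β e = o.run β e := rfl

@[simp] theorem run_ifLt (x y : V) (p q : LoopProg V K B) (e : Store V K) :
    (ifLt x y p q).run β e = if e.var x < e.var y then p.run β e else q.run β e := rfl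

@[simp] theorem run_chain_nil (e : Store V K) : (chain [] : LoopProg V K B).run β e = e := rfl

@[simp] theorem run_chain_cons (p : LoopProg V K B) (l : List (LoopProg V K B)) (e : Store V K) :
    (chain (p :: l)).run β e = (chain l).run β (p.run β e) := rfl

end LoopProg

end Semantics

/-! ### Growth of the values -/

/-- A bound on the increase of the maximal value by an elementary operation. -/
def Op.growth : Op V K B → ℕ
  | .const _ c => c
  | .inc _ _ => 1
  | _ => 0

/-- A bound on the increase of the maximal value, as a polynomial in the loop bounds. -/
noncomputable def LoopProg.growth : LoopProg V K B → Polynomial ℕ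
  | .skip => 0
  | .op o => (o.growth : Polynomial ℕ)
  | .seq p q | .ifLt _ _ p q => p.growth + q.growth
  | .loop _ _ p => Polynomial.X * p.growth

section Growth

variable [DecidableEq V] [DecidableEq K] {β : B → ℕ} {q M : ℕ} {e : Store V K}

theorem Op.bounded_run (hβ : ∀ b, β b ≤ M) (o : Op V K B) (h : e.Bounded M) :
    (o.run β e).Bounded (M + o.growth) := by
  cases o with
  | const x c => exact (h.mono (Nat.le_add_right _ _)).setVar _ (Nat.le_add_left _ _)
  | bound x b => exact h.setVar _ (hβ b)
  | inc x y => exact (h.mono (Nat.le_add_right _ _)).setVar _ (Nat.succ_le_succ (h.var y))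
  | copy x y => exact h.setVar _ (h.var y)
  | get x k y => exact h.setVar _ (h.arr k _)
  | set k y x => exact h.setArr _ _ (h.var x)
  | read x =>
    exact { h.setVar x h.inp_headD with inp := fun a ha => h.inp a (List.mem_of_mem_tail ha) }
  | print x => exact ⟨h.var, h.arr, h.inp⟩

namespace LoopProg

theorem bounded_foldl_range {p : LoopProg V K B} {g : ℕ} (hqM : q ≤ M)
    (hp : ∀ M e, q ≤ M → e.Bounded M → (p.run β e).Bounded (M + g)) (h : e.Bounded M) (i : V)
    {n : ℕ} (hn : n ≤ q) :
    ((List.range n).foldl (fun e' k => p.run β (e'.setVar i k)) e).Bounded (M + n * g) := by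
  refine foldl_range_induction (fun k (e' : Store V K) => e'.Bounded (M + k * g)) (by simpa using h)
    fun k e' hk he' => ?_
  rw [Nat.succ_mul, ← Nat.add_assoc]
  exact hp _ _ (by omega) (he'.setVar i (by omega))

theorem bounded_run (hβ : ∀ b, β b ≤ q) (hqM : q ≤ M) (p : LoopProg V K B) (h : e.Bounded M) :
    (p.run β e).Bounded (M + p.growth.eval q) := by
  induction p generalizing M e with
  | skip => simpa [growth] using h
  | op o => simpa [growth] using o.bounded_run (fun b => (hβ b).trans hqM) h
  | seq p r hp hr =>
    rw [growth, Polynomial.eval_add, ← Nat.add_assoc]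
    exact hr (by omega) (hp hqM h)
  | ifLt x y p r hp hr =>
    rw [growth, Polynomial.eval_add, run]
    split_ifs
    exacts [(hp hqM h).mono (by omega), (hr hqM h).mono (by omega)]
  | loop i b p hp =>
    rw [growth, Polynomial.eval_mul, Polynomial.eval_X]
    refine (bounded_foldl_range hqM (fun M e hM he => hp hM he) h i (hβ b)).mono ?_
    gcongr
    exact hβ b

end LoopProg

end Growth

end RAM

/-! ### Compilation to random access machines -/

namespace RAM

universe u₁ u₂ u₃

theorem len_mono : Monotone len := fun _ _ h => Nat.succ_le_succ (Nat.size_le_size h)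

theorem one_le_len (x : ℕ) : 1 ≤ len x := Nat.le_add_left 1 _

/-- The total correctness triple with running time: started in `s`, the program `P` halts at cost
at most `T` in a state that satisfies `Q`. -/
def HaltsWithin (P : Prog) (s : State) (T : ℕ) (Q : State → Prop) : Prop :=
  ∃ t s', Exec P s t s' ∧ t ≤ T ∧ Q s'

namespace HaltsWithin

variable {P P' : Prog} {s : State} {T T' : ℕ} {Q Q' : State → Prop}

theorem mono (h : HaltsWithin P s T Q) (hT : T ≤ T') (hQ : ∀ s', Q s' → Q' s') :
    HaltsWithin P s T' Q' :=
  let ⟨t, s', hP, ht, hs'⟩ := h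
  ⟨t, s', hP, ht.trans hT, hQ s' hs'⟩

theorem skip (h : Q s) : HaltsWithin .skip s 1 Q := ⟨1, s, .skip s, le_rfl, h⟩

theorem seq (h : HaltsWithin P s T Q) (h' : ∀ s', Q s' → HaltsWithin P' s' T' Q') :
    HaltsWithin (.seq P P') s (T + T') Q' :=
  let ⟨_, s₁, hP, ht, hs₁⟩ := h
  let ⟨_, s₂, hP', ht', hs₂⟩ := h' s₁ hs₁
  ⟨_, s₂, .seq hP hP', Nat.add_le_add ht ht', hs₂⟩

theorem ifPos {i : ℕ} (h : 0 < s.reg i → HaltsWithin P s T Q)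
    (h' : s.reg i = 0 → HaltsWithin P' s T Q) :
    HaltsWithin (.ifPos i P P') s (len (s.reg i) + T) Q := by
  rcases (s.reg i).eq_zero_or_pos with hi | hi
  · obtain ⟨t, s', hP, ht, hs'⟩ := h' hi
    exact ⟨_, s', .ifFalse hi hP, by gcongr, hs'⟩
  · obtain ⟨t, s', hP, ht, hs'⟩ := h hi
    exact ⟨_, s', .ifTrue hi hP, by gcongr, hs'⟩

theorem whilePos {i n : ℕ} (I : ℕ → State → Prop) (hI : ∀ r s, I r s → s.reg i = r)
    (body : ∀ r s, r < n → I (r + 1) s → HaltsWithin P s T (I r)) (hs : I n s) :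
    HaltsWithin (.whilePos i P) s (n * (T + len n) + len n) (I 0) := by
  suffices ∀ r s, r ≤ n → I r s →
      HaltsWithin (.whilePos i P) s (r * (T + len n) + len n) (I 0) from this n s le_rfl hs
  intro r
  induction r with
  | zero =>
    intro s _ hs
    refine ⟨_, s, .whileFalse (hI 0 s hs), ?_, hs⟩
    rw [hI 0 s hs, Nat.zero_mul, Nat.zero_add]
    exact len_mono n.zero_le
  | succ r ih =>
    intro s hr hs
    have hi := hI _ s hs
    obtain ⟨t₁, s₁, h₁, ht₁, hs₁⟩ := body r s hr hs
    obtain ⟨t₂, s₂, h₂, ht₂, hs₂⟩ := ih s₁ (Nat.le_of_succ_le hr) hs₁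
    refine ⟨_, s₂, .whileTrue (by omega) h₁ h₂, ?_, hs₂⟩
    have : len (s.reg i) ≤ len n := len_mono (hi.trans_le hr)
    rw [Nat.succ_mul]
    omega

end HaltsWithin

/-- Straight-line code. -/
def block : List Instr → Prog
  | [] => .skip
  | a :: l => .seq (.instr a) (block l)

/-- The effect of `block`. -/
def blockEffect : List Instr → State → State
  | [], s => s
  | a :: l, s => blockEffect l (a.effect s)

/-- The cost of `block`; the final `skip` costs `1`. -/
def blockCost : List Instr → State → ℕ
  | [], _ => 1
  | a :: l, s => a.cost s + blockCost l (a.effect s)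

theorem exec_block (l : List Instr) (s : State) :
    Exec (block l) s (blockCost l s) (blockEffect l s) := by
  induction l generalizing s with
  | nil => exact .skip s
  | cons a l ih => exact .seq (.instr a s) (ih _)

theorem haltsWithin_block {l : List Instr} {s : State} {T : ℕ} {Q : State → Prop}
    (hT : blockCost l s ≤ T) (hQ : Q (blockEffect l s)) : HaltsWithin (block l) s T Q :=
  ⟨_, _, exec_block l s, hT, hQ⟩

theorem blockEffect_concat (l : List Instr) (a : Instr) (s : State) :
    blockEffect (l ++ [a]) s = a.effect (blockEffect l s) := by
  induction l generalizing s with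
  | nil => rfl
  | cons b _ ih => exact ih _

theorem blockCost_concat (l : List Instr) (a : Instr) (s : State) :
    blockCost (l ++ [a]) s = blockCost l s + a.cost (blockEffect l s) := by
  induction l generalizing s with
  | nil => exact Nat.add_comm _ _
  | cons b _ ih => exact (congrArg (_ + ·) (ih _)).trans (Nat.add_assoc ..).symm

/-- An assignment of registers to the variables, arrays and loop bounds of a loop program. The
registers are divided into residue classes modulo `8`: one for each of up to five arrays, one for
the variables, one for loop counters and bounds, and one for scratch registers. -/
structure Layout (V : Type u₁) (K : Type u₂) (B : Type u₃) where
  var : V ↪ ℕ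
  arr : K ↪ Fin 5
  bound : B → ℕ

/-- The registers used by a compiled loop program. -/
inductive Cell (V : Type u₁) (K : Type u₂) where
  | var (x : V)
  | arr (k : K) (i : ℕ)
  /-- A loop bound or the number of remaining iterations of a loop. -/
  | guard (j : ℕ)
  /-- The address of an array entry. -/
  | addr
  /-- An auxiliary summand or the condition of a branch. -/
  | aux

variable {V : Type u₁} {K : Type u₂} {B : Type u₃}

namespace Layout

variable (L : Layout V K B)

/-- The number of the register at which a cell is located. -/
def reg : Cell V K → ℕ
  | .arr k i => 8 * i + L.arr k
  | .var x => 8 * L.var x + 5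
  | .guard j => 8 * j + 6
  | .addr => 7
  | .aux => 15

theorem reg_injective : Function.Injective L.reg := by
  rintro (x | ⟨k, i⟩ | j | - | -) (y | ⟨l, i'⟩ | j' | - | -) h <;> simp only [reg] at h
  case var.var => rw [L.var.injective (a₁ := x) (a₂ := y) (by omega)]
  case arr.arr =>
    have := (L.arr k).isLt
    have := (L.arr l).isLt
    rw [L.arr.injective (a₁ := k) (a₂ := l) (Fin.ext (by omega)), show i = i' by omega]
  case guard.guard => rw [show j = j' by omega]
  all_goals first
    | rfl
    | (have := (L.arr k).isLt; omega)
    | (have := (L.arr l).isLt; omega)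
    | omega

@[simp] theorem reg_inj {c c' : Cell V K} : L.reg c = L.reg c' ↔ c = c' :=
  L.reg_injective.eq_iff

/-- The store of a loop program that is represented by a machine state. -/
def store (s : State) : Store V K :=
  ⟨fun x => s.reg (L.reg (.var x)), fun k i => s.reg (L.reg (.arr k i)), s.inp, s.out⟩

/-- The loop bounds in a machine state are `β`. -/
def HasBounds (β : B → ℕ) (s : State) : Prop := ∀ b, s.reg (L.reg (.guard (L.bound b))) = β b

/-- The address computation for `k[y]`. -/
def addrCode (k : K) (y : V) : List Instr :=
  [.add (L.reg .addr) (L.reg (.var y)) (L.reg (.var y)),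
    .add (L.reg .addr) (L.reg .addr) (L.reg .addr),
    .add (L.reg .addr) (L.reg .addr) (L.reg .addr),
    .const (L.reg .aux) (L.arr k), .add (L.reg .addr) (L.reg .addr) (L.reg .aux)]

/-- The code of `x := (register r) + c`. -/
def addConstCode (x : V) (r c : ℕ) : List Instr :=
  [.const (L.reg .aux) c, .add (L.reg (.var x)) r (L.reg .aux)]

/-- The code of an elementary operation. -/
def opCode : Op V K B → List Instr
  | .const x c => [.const (L.reg (.var x)) c]
  | .bound x b => L.addConstCode x (L.reg (.guard (L.bound b))) 0
  | .inc x y => L.addConstCode x (L.reg (.var y)) 1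
  | .copy x y => L.addConstCode x (L.reg (.var y)) 0
  | .get x k y => L.addrCode k y ++ [.load (L.reg (.var x)) (L.reg .addr)]
  | .set k y x => L.addrCode k y ++ [.store (L.reg .addr) (L.reg (.var x))]
  | .read x => [.read (L.reg (.var x))]
  | .print x => [.print (L.reg (.var x))]

/-- One iteration of a loop over `i` with body `P`: since the guard counts the remaining iterations,
`i` is the difference of the bound and the guard. -/
def iteration (d : ℕ) (i : V) (b : B) (P : Prog) : Prog :=
  .seq (block [.sub (L.reg (.var i)) (L.reg (.guard (L.bound b))) (L.reg (.guard d))])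
    (.seq P
      (block [.const (L.reg .aux) 1, .sub (L.reg (.guard d)) (L.reg (.guard d)) (L.reg .aux)]))

/-- The code of a loop program that is nested in loops with guards less than `d`. -/
def code : ℕ → LoopProg V K B → Prog
  | _, .skip => .skip
  | _, .op o => block (L.opCode o)
  | d, .seq p q => .seq (code d p) (code d q)
  | d, .ifLt x y p q =>
    .seq (block [.sub (L.reg .aux) (L.reg (.var y)) (L.reg (.var x))])
      (.ifPos (L.reg .aux) (code d p) (code d q))
  | d, .loop i b p =>
    .seq (block [.const (L.reg .aux) 0,
        .add (L.reg (.guard d)) (L.reg (.guard (L.bound b))) (L.reg .aux)])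
      (.whilePos (L.reg (.guard d)) (L.iteration d i b (code (d + 1) p)))

end Layout

/-- A bound on the cost of handling a number or an address if all values are at most `M`. -/
def unitCost (M : ℕ) : ℕ := len (8 * M + 8)

theorem unitCost_mono : Monotone unitCost := fun _ _ h => len_mono (by omega)

theorem len_le_unitCost {x M : ℕ} (h : x ≤ 8 * M + 8) : len x ≤ unitCost M := len_mono h

theorem one_le_unitCost (M : ℕ) : 1 ≤ unitCost M := one_le_len _

/-- A bound on the cost of a loop program in multiples of `unitCost`, as a polynomial in the loop
bounds. -/
noncomputable def LoopProg.cost : LoopProg V K B → Polynomial ℕ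
  | .skip => 1
  | .op _ => 12
  | .seq p q => p.cost + q.cost
  | .ifLt _ _ p q => 4 + (p.cost + q.cost)
  | .loop _ _ p => 5 + Polynomial.X * (p.cost + 8)

namespace Layout

variable (L : Layout V K B) {s : State} {M : ℕ} {β : B → ℕ}

theorem blockEffect_addrCode (k : K) (y : V) (s : State) :
    blockEffect (L.addrCode k y) s =
      { s with
        reg := Function.update (Function.update s.reg (L.reg .aux) (L.arr k)) (L.reg .addr)
          (L.reg (.arr k (s.reg (L.reg (.var y))))) } := by
  simp only [addrCode, blockEffect, Instr.effect, State.mk.injEq, and_true]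
  funext r
  simp only [Function.update_apply, reg_inj, reduceCtorEq, if_true, if_false]
  split_ifs
  exacts [by simp only [reg]; omega, rfl, rfl]

theorem blockCost_addrCode_le (k : K) (y : V) (h : s.reg (L.reg (.var y)) ≤ M) :
    blockCost (L.addrCode k y) s ≤ 10 * unitCost M := by
  have hk := (L.arr k).isLt
  have hy := len_le_unitCost (x := s.reg (L.reg (.var y))) (M := M) (by omega)
  have hy₂ := len_le_unitCost (x := s.reg (L.reg (.var y)) + s.reg (L.reg (.var y))) (M := M)
    (by omega)
  have hy₄ := len_le_unitCost (M := M) (x := s.reg (L.reg (.var y)) + s.reg (L.reg (.var y)) +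
    (s.reg (L.reg (.var y)) + s.reg (L.reg (.var y)))) (by omega)
  have hy₈ := len_le_unitCost (M := M) (x := s.reg (L.reg (.var y)) + s.reg (L.reg (.var y)) +
    (s.reg (L.reg (.var y)) + s.reg (L.reg (.var y))) +
      (s.reg (L.reg (.var y)) + s.reg (L.reg (.var y)) +
    (s.reg (L.reg (.var y)) + s.reg (L.reg (.var y))))) (by omega)
  have hk' := len_le_unitCost (x := L.arr k) (M := M) (by omega)
  have := one_le_unitCost M
  simp only [addrCode, blockCost, Instr.effect, Instr.cost, Function.update_apply, reg_inj,
    reduceCtorEq, if_true, if_false]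
  omega

section

variable [DecidableEq V]

theorem store_update_var (r : ℕ → ℕ) (i o : List ℕ) (x : V) (n : ℕ) :
    L.store ⟨Function.update r (L.reg (.var x)) n, i, o⟩ = (L.store ⟨r, i, o⟩).setVar x n := by
  simp only [store, Store.setVar, Store.mk.injEq, and_true, Function.update_apply, reg_inj,
    reduceCtorEq, if_false, Cell.var.injEq]
  funext y
  rw [Function.update_apply]

end

section

variable [DecidableEq K]

theorem store_update_arr (r : ℕ → ℕ) (i o : List ℕ) (k : K) (j n : ℕ) :
    L.store ⟨Function.update r (L.reg (.arr k j)) n, i, o⟩ =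
      (L.store ⟨r, i, o⟩).setArr k j n := by
  simp only [store, Store.setArr, Store.mk.injEq, and_true, true_and, Function.update_apply,
    reg_inj, reduceCtorEq, if_false, Cell.arr.injEq]
  funext l j'
  by_cases hl : l = k <;> simp [hl, Function.update_apply]

end

theorem store_update_of_ne (r : ℕ → ℕ) (i o : List ℕ) {c : Cell V K} (hx : ∀ x, c ≠ .var x)
    (hk : ∀ k j, c ≠ .arr k j) (n : ℕ) :
    L.store ⟨Function.update r (L.reg c) n, i, o⟩ = L.store ⟨r, i, o⟩ := by
  simp [store, (hx _).symm, (hk _ _).symm]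

theorem store_addrCode (k : K) (y : V) (s : State) :
    L.store (blockEffect (L.addrCode k y) s) = L.store s := by
  simp [blockEffect_addrCode, store]

theorem reg_guard_opCode (o : Op V K B) (s : State) (j : ℕ) :
    (blockEffect (L.opCode o) s).reg (L.reg (.guard j)) = s.reg (L.reg (.guard j)) := by
  cases o <;> simp [opCode, addConstCode, blockEffect_concat, blockEffect_addrCode, blockEffect,
    Instr.effect]

section

variable [DecidableEq V]

theorem store_addConstCode (x : V) {c : Cell V K} (hc : c ≠ .aux) (a : ℕ) :
    L.store (blockEffect (L.addConstCode x (L.reg c) a) s) =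
      (L.store s).setVar x (s.reg (L.reg c) + a) := by
  simp only [addConstCode, blockEffect, Instr.effect]
  rw [store_update_var, store_update_of_ne _ _ _ _ (by simp) (by simp)]
  simp [hc]

variable [DecidableEq K]

theorem store_opCode (hβ : L.HasBounds β s) (o : Op V K B) :
    L.store (blockEffect (L.opCode o) s) = o.run β (L.store s) := by
  cases o with
  | const x c => exact L.store_update_var ..
  | bound x b => rw [opCode, store_addConstCode _ _ (by simp), hβ]; rfl
  | inc x y => exact L.store_addConstCode x (by simp) 1
  | copy x y => exact L.store_addConstCode x (by simp) 0
  | get x k y =>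
    rw [opCode, blockEffect_concat, Instr.effect, store_update_var, store_addrCode]
    simp [blockEffect_addrCode, Op.run, store]
  | set k y x =>
    rw [opCode, blockEffect_concat, Instr.effect]
    have haddr : (blockEffect (L.addrCode k y) s).reg (L.reg .addr) =
        L.reg (.arr k ((L.store s).var y)) := by simp [blockEffect_addrCode, store]
    rw [haddr, store_update_arr, store_addrCode]
    simp [blockEffect_addrCode, Op.run, store]
  | read x => exact L.store_update_var ..
  | print x => rfl

end

theorem blockCost_addConstCode_le (x : V) {c : Cell V K} (hc : c ≠ .aux)
    (h : s.reg (L.reg c) ≤ M) {a : ℕ} (ha : a ≤ 1) :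
    blockCost (L.addConstCode x (L.reg c) a) s ≤ 4 * unitCost M := by
  have hlen := len_le_unitCost (x := s.reg (L.reg c)) (M := M) (by omega)
  have ha := len_le_unitCost (x := a) (M := M) (by omega)
  have := one_le_unitCost M
  simp only [addConstCode, blockCost, Instr.effect, Instr.cost, Function.update_apply, reg_inj,
    hc, if_true, if_false]
  omega

theorem blockCost_opCode_le (hβ : L.HasBounds β s) (hM : ∀ b, β b ≤ M)
    (h : (L.store s).Bounded M) (o : Op V K B) :
    blockCost (L.opCode o) s ≤ 12 * unitCost (M + o.growth) := by
  have hvar (x : V) : s.reg (L.reg (.var x)) ≤ M := h.var x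
  have hlen {a : ℕ} (ha : a ≤ M) : len a ≤ unitCost M := len_le_unitCost (by omega)
  have haddr (k : K) (y : V) : len (L.reg (.arr k (s.reg (L.reg (.var y))))) ≤ unitCost M := by
    have := (L.arr k).isLt
    have := hvar y
    exact len_le_unitCost (by simp only [reg] at this ⊢; omega)
  have := one_le_unitCost M
  cases o with
  | const x c =>
    have hc := len_le_unitCost (x := c) (M := M + c) (by omega)
    simp only [opCode, blockCost, Instr.cost, Op.growth]
    have := one_le_unitCost (M + c)
    omega
  | bound x b =>
    have := L.blockCost_addConstCode_le x (c := .guard (L.bound b)) (by simp)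
      ((hβ b).trans_le (hM b)) zero_le_one
    simp only [opCode, Op.growth, add_zero]
    omega
  | inc x y =>
    have := L.blockCost_addConstCode_le x (c := .var y) (by simp) (hvar y) le_rfl
    have := unitCost_mono (Nat.le_add_right M 1)
    simp only [opCode, Op.growth]
    omega
  | copy x y =>
    have := L.blockCost_addConstCode_le x (c := .var y) (by simp) (hvar y) zero_le_one
    simp only [opCode, Op.growth, add_zero]
    omega
  | get x k y =>
    have := L.blockCost_addrCode_le k y (hvar y)
    have := haddr k y
    have := hlen (h.arr k (s.reg (L.reg (.var y))))
    simp only [opCode, blockCost_concat, Instr.cost, Op.growth, add_zero, blockEffect_addrCode,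
      Function.update_self, Function.update_apply, reg_inj, reduceCtorEq, if_false]
    simp only [store] at this
    omega
  | set k y x =>
    have := L.blockCost_addrCode_le k y (hvar y)
    have := haddr k y
    have := hlen (hvar x)
    simp only [opCode, blockCost_concat, Instr.cost, Op.growth, add_zero, blockEffect_addrCode,
      Function.update_apply, reg_inj, reduceCtorEq, if_true, if_false]
    omega
  | read x =>
    have : len (s.inp.headD 0) ≤ unitCost M := hlen h.inp_headD
    simp only [opCode, blockCost, Instr.cost, Op.growth, add_zero]
    omega
  | print x =>
    have := hlen (hvar x)
    simp only [opCode, blockCost, Instr.cost, Op.growth, add_zero]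
    omega

/-- In states that represent a store with values at most `M`, the code `P` at nesting depth `d`
transforms the store by `f` at cost at most `T`, without affecting the enclosing loops. -/
def Implements (β : B → ℕ) (d M : ℕ) (P : Prog) (f : Store V K → Store V K) (T : ℕ) : Prop :=
  ∀ s, L.HasBounds β s → (L.store s).Bounded M → HaltsWithin P s T fun s' =>
    L.store s' = f (L.store s) ∧ ∀ j < d, s'.reg (L.reg (.guard j)) = s.reg (L.reg (.guard j))

variable {L} in
theorem HasBounds.congr {s s' : State} {d : ℕ} (h : L.HasBounds β s) (hd : ∀ b, L.bound b < d)
    (hs : ∀ j < d, s'.reg (L.reg (.guard j)) = s.reg (L.reg (.guard j))) : L.HasBounds β s' :=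
  fun b => (hs _ (hd b)).trans (h b)

theorem haltsWithin_test (x y : V) (h : (L.store s).Bounded M) :
    HaltsWithin (block [.sub (L.reg .aux) (L.reg (.var y)) (L.reg (.var x))]) s (3 * unitCost M)
      fun s' => s'.reg (L.reg .aux) = (L.store s).var y - (L.store s).var x ∧
        L.store s' = L.store s ∧ ∀ j, s'.reg (L.reg (.guard j)) = s.reg (L.reg (.guard j)) := by
  refine haltsWithin_block ?_ ⟨?_, L.store_update_of_ne _ _ _ (by simp) (by simp) _, fun j => ?_⟩
  · have hx : len (s.reg (L.reg (.var x))) ≤ unitCost M :=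
      len_le_unitCost ((h.var x).trans (by omega))
    have hy : len (s.reg (L.reg (.var y))) ≤ unitCost M :=
      len_le_unitCost ((h.var y).trans (by omega))
    have := one_le_unitCost M
    simp only [blockCost, Instr.cost]
    omega
  · simp [blockEffect, Instr.effect, store]
  · simp [blockEffect, Instr.effect]

theorem haltsWithin_setGuard {d j n : ℕ} (hs : s.reg (L.reg (.guard j)) = n)
    (hn : n ≤ M) :
    HaltsWithin (block [.const (L.reg .aux) 0,
        .add (L.reg (.guard d)) (L.reg (.guard j)) (L.reg .aux)]) s (4 * unitCost M)
      fun s' => s'.reg (L.reg (.guard d)) = n ∧ L.store s' = L.store s ∧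
        ∀ j' < d, s'.reg (L.reg (.guard j')) = s.reg (L.reg (.guard j')) := by
  refine haltsWithin_block ?_ ⟨?_, ?_, fun j' hj' => ?_⟩
  · have := len_le_unitCost (x := n) (M := M) (by omega)
    have := len_le_unitCost (x := 0) (M := M) (by omega)
    have := one_le_unitCost M
    simp [blockCost, Instr.effect, Instr.cost, hs]
    omega
  · simp [blockEffect, Instr.effect, hs]
  · simp [blockEffect, Instr.effect, store]
  · simp [blockEffect, Instr.effect, hj'.ne]

theorem haltsWithin_decGuard {d r : ℕ} (hs : s.reg (L.reg (.guard d)) = r + 1) (hr : r + 1 ≤ M) :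
    HaltsWithin (block [.const (L.reg .aux) 1,
        .sub (L.reg (.guard d)) (L.reg (.guard d)) (L.reg .aux)]) s (4 * unitCost M)
      fun s' => s'.reg (L.reg (.guard d)) = r ∧ L.store s' = L.store s ∧
        ∀ j < d, s'.reg (L.reg (.guard j)) = s.reg (L.reg (.guard j)) := by
  refine haltsWithin_block ?_ ⟨?_, ?_, fun j' hj' => ?_⟩
  · have := len_le_unitCost (x := r + 1) (M := M) (by omega)
    have := len_le_unitCost (x := 1) (M := M) (by omega)
    have := one_le_unitCost M
    simp [blockCost, Instr.effect, Instr.cost, hs]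
    omega
  · simp [blockEffect, Instr.effect, hs]
  · simp [blockEffect, Instr.effect, store]
  · simp [blockEffect, Instr.effect, hj'.ne]

variable {L} in
theorem Implements.mono {d T T' : ℕ} {P : Prog} {f : Store V K → Store V K}
    (h : L.Implements β d M P f T) (hT : T ≤ T') : L.Implements β d M P f T' :=
  fun s hβ hs => (h s hβ hs).mono hT fun _ => id

theorem implements_skip (β : B → ℕ) (d M : ℕ) : L.Implements β d M .skip id 1 :=
  fun _ _ _ => .skip ⟨rfl, fun _ _ => rfl⟩

variable {L} in
theorem Implements.seq {d M' T T' : ℕ} {P P' : Prog} {f f' : Store V K → Store V K}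
    (hd : ∀ b, L.bound b < d) (h : L.Implements β d M P f T)
    (hf : ∀ e, e.Bounded M → (f e).Bounded M') (h' : L.Implements β d M' P' f' T') :
    L.Implements β d M (.seq P P') (f' ∘ f) (T + T') := by
  intro s hβ hs
  refine (h s hβ hs).seq fun s₁ ⟨hstore₁, hframe₁⟩ => ?_
  refine (h' s₁ (hβ.congr hd hframe₁) (hstore₁ ▸ hf _ hs)).mono le_rfl ?_
  rintro s₂ ⟨hstore₂, hframe₂⟩
  exact ⟨by rw [hstore₂, hstore₁]; rfl, fun j hj => (hframe₂ j hj).trans (hframe₁ j hj)⟩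

variable [DecidableEq V]

theorem haltsWithin_setCounter {d j n : ℕ} (i : V) (hs : s.reg (L.reg (.guard j)) = n)
    (hn : n ≤ M) (hr : s.reg (L.reg (.guard d)) ≤ M) :
    HaltsWithin (block [.sub (L.reg (.var i)) (L.reg (.guard j)) (L.reg (.guard d))]) s
      (3 * unitCost M) fun s' =>
        L.store s' = (L.store s).setVar i (n - s.reg (L.reg (.guard d))) ∧
          ∀ j', s'.reg (L.reg (.guard j')) = s.reg (L.reg (.guard j')) := by
  refine haltsWithin_block ?_ ⟨?_, fun j' => ?_⟩
  · have := len_le_unitCost (x := n) (M := M) (by omega)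
    have := len_le_unitCost (x := s.reg (L.reg (.guard d))) (M := M) (by omega)
    have := one_le_unitCost M
    simp only [blockCost, Instr.cost, hs]
    omega
  · simp only [blockEffect, Instr.effect, store_update_var, hs]
  · simp [blockEffect, Instr.effect]

theorem haltsWithin_iteration {d T r : ℕ} {P : Prog} {f : Store V K → Store V K} {i : V} {b : B}
    (hβ : L.HasBounds β s) (hM : β b ≤ M) (h : (L.store s).Bounded M)
    (hP : L.Implements β (d + 1) M P f T) (hs : s.reg (L.reg (.guard d)) = r + 1)
    (hr : r + 1 ≤ β b) :
    HaltsWithin (L.iteration d i b P) s (3 * unitCost M + (T + 4 * unitCost M)) fun s' =>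
      s'.reg (L.reg (.guard d)) = r ∧ L.store s' = f ((L.store s).setVar i (β b - (r + 1))) ∧
        ∀ j < d, s'.reg (L.reg (.guard j)) = s.reg (L.reg (.guard j)) := by
  refine (L.haltsWithin_setCounter i (hβ b) hM (hs.trans_le (hr.trans hM))).seq ?_
  rintro s₁ ⟨hstore₁, hguard₁⟩
  rw [hs] at hstore₁
  refine (hP s₁ (fun b => (hguard₁ _).trans (hβ b)) ?_).seq ?_
  · rw [hstore₁]
    exact h.setVar i (by omega)
  rintro s₂ ⟨hstore₂, hguard₂⟩
  have hs₂ : s₂.reg (L.reg (.guard d)) = r + 1 :=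
    (hguard₂ d d.lt_succ_self).trans ((hguard₁ d).trans hs)
  refine (L.haltsWithin_decGuard hs₂ (hr.trans hM)).mono le_rfl ?_
  rintro s₃ ⟨hs₃, hstore₃, hguard₃⟩
  refine ⟨hs₃, by rw [hstore₃, hstore₂, hstore₁], fun j hj => ?_⟩
  rw [hguard₃ j hj, hguard₂ j (hj.trans d.lt_succ_self), hguard₁]

variable [DecidableEq K]

theorem implements_op (hM : ∀ b, β b ≤ M) (o : Op V K B) (d : ℕ) :
    L.Implements β d M (block (L.opCode o)) (o.run β) (12 * unitCost (M + o.growth)) :=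
  fun _ hβ h => haltsWithin_block (L.blockCost_opCode_le hβ hM h o)
    ⟨L.store_opCode hβ o, fun j _ => L.reg_guard_opCode o _ j⟩

theorem implements_ifLt {d T : ℕ} {p r : LoopProg V K B} (x y : V)
    (hp : L.Implements β d M (L.code d p) (p.run β) T)
    (hr : L.Implements β d M (L.code d r) (r.run β) T) :
    L.Implements β d M (L.code d (.ifLt x y p r)) ((LoopProg.ifLt x y p r).run β)
      (4 * unitCost M + T) := by
  intro s hβ h
  refine ((L.haltsWithin_test x y h).seq (T' := unitCost M + T) ?_).mono (by omega) fun _ => id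
  rintro s₁ ⟨haux, hstore, hguard⟩
  have hβ₁ : L.HasBounds β s₁ := fun b => (hguard _).trans (hβ b)
  have hy := h.var y
  refine (HaltsWithin.ifPos (T := T) (fun hpos => ?_) fun hzero => ?_).mono
    (Nat.add_le_add_right (len_le_unitCost (by omega)) _) fun _ => id
  · refine (hp s₁ hβ₁ (hstore ▸ h)).mono le_rfl fun s' hs' => ?_
    rw [LoopProg.run_ifLt, if_pos (by omega)]
    exact ⟨hstore ▸ hs'.1, fun j hj => (hs'.2 j hj).trans (hguard j)⟩
  · refine (hr s₁ hβ₁ (hstore ▸ h)).mono le_rfl fun s' hs' => ?_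
    rw [LoopProg.run_ifLt, if_neg (by omega)]
    exact ⟨hstore ▸ hs'.1, fun j hj => (hs'.2 j hj).trans (hguard j)⟩

theorem implements_loop {d T q g : ℕ} {p : LoopProg V K B} (i : V) (b : B)
    (hd : ∀ b, L.bound b < d) (hb : β b ≤ q) (hqM : q ≤ M)
    (hg : ∀ M e, q ≤ M → e.Bounded M → (p.run β e).Bounded (M + g))
    (hp : ∀ M', q ≤ M' → M' + g ≤ M + q * g →
      L.Implements β (d + 1) M' (L.code (d + 1) p) (p.run β) T) :
    L.Implements β d M (L.code d (.loop i b p)) ((LoopProg.loop i b p).run β)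
      (5 * unitCost (M + q * g) + β b * (T + 8 * unitCost (M + q * g))) := by
  intro s hβ h
  set U := unitCost (M + q * g)
  have hU {M'} (h : M' ≤ M + q * g) : unitCost M' ≤ U := unitCost_mono h
  have hlen : len (β b) ≤ U := len_le_unitCost (by omega)
  refine ((L.haltsWithin_setGuard (hβ b) (hb.trans hqM)).seq
    (T' := β b * (T + 7 * U + len (β b)) + len (β b)) ?_).mono ?_ fun _ => id
  swap
  · have : β b * (T + 7 * U + len (β b)) ≤ β b * (T + 8 * U) := Nat.mul_le_mul_left _ (by omega)
    have := hU (M.le_add_right _)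
    omega
  rintro s₁ ⟨hguard, hstore, hframe⟩
  refine (HaltsWithin.whilePos (n := β b) (T := T + 7 * U) (fun r s' =>
    s'.reg (L.reg (.guard d)) = r ∧
      L.store s' = (List.range (β b - r)).foldl (fun e k => p.run β (e.setVar i k)) (L.store s) ∧
      ∀ j < d, s'.reg (L.reg (.guard j)) = s.reg (L.reg (.guard j)))
    (fun _ _ => And.left) ?_ ⟨hguard, by simpa using hstore, hframe⟩).mono le_rfl fun _ => And.right
  rintro r s' hr ⟨hguard', hstore', hframe'⟩
  obtain ⟨k, hk⟩ : ∃ k, β b - (r + 1) = k := ⟨_, rfl⟩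
  have hkg : k * g + g ≤ q * g := by
    rw [← Nat.succ_mul]
    exact Nat.mul_le_mul_right _ (by omega)
  have hbounded : (L.store s').Bounded (M + k * g) :=
    hstore' ▸ hk ▸ LoopProg.bounded_foldl_range hqM hg h i (by omega)
  refine (L.haltsWithin_iteration (hβ.congr hd hframe') (by omega) hbounded
    (hp _ (by omega) (by omega)) hguard' hr).mono ?_ ?_
  · have := hU (M' := M + k * g) (by omega)
    omega
  rintro s'' ⟨hguard'', hstore'', hframe''⟩
  refine ⟨hguard'', ?_, fun j hj => (hframe'' j hj).trans (hframe' j hj)⟩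
  rw [hstore'', hstore', hk, show β b - r = k + 1 by omega, List.range_succ, List.foldl_append]
  rfl

theorem implements_code {d q : ℕ} (hd : ∀ b, L.bound b < d) (hq : ∀ b, β b ≤ q) (hqM : q ≤ M)
    (p : LoopProg V K B) :
    L.Implements β d M (L.code d p) (p.run β)
      (p.cost.eval q * unitCost (M + p.growth.eval q)) := by
  induction p generalizing d M with
  | skip =>
    refine (L.implements_skip β d M).mono ?_
    simpa only [LoopProg.cost, Polynomial.eval_one, one_mul] using one_le_unitCost _
  | op o =>
    rw [LoopProg.cost, LoopProg.growth, Polynomial.eval_natCast, Polynomial.eval_ofNat]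
    exact L.implements_op (fun b => (hq b).trans hqM) o d
  | seq p r hp hr =>
    rw [LoopProg.cost, LoopProg.growth, Polynomial.eval_add, Polynomial.eval_add, add_mul,
      ← add_assoc]
    refine ((hp hd hqM).seq hd (fun _ => p.bounded_run hq hqM) (hr hd (by omega))).mono ?_
    gcongr
    exact unitCost_mono (Nat.le_add_right _ _)
  | ifLt x y p r hp hr =>
    rw [LoopProg.cost, LoopProg.growth, Polynomial.eval_add, Polynomial.eval_add,
      Polynomial.eval_add, Polynomial.eval_ofNat, add_mul]
    refine (L.implements_ifLt x y ((hp hd hqM).mono (Nat.mul_le_mul (Nat.le_add_right _ _) ?_))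
      ((hr hd hqM).mono (Nat.mul_le_mul (Nat.le_add_left _ _) ?_))).mono
        (Nat.add_le_add_right (Nat.mul_le_mul_left _ ?_) _) <;>
    exact unitCost_mono (by omega)
  | loop i b p hp =>
    simp only [LoopProg.cost, LoopProg.growth, Polynomial.eval_add, Polynomial.eval_mul,
      Polynomial.eval_X, Polynomial.eval_ofNat]
    set U := unitCost (M + q * p.growth.eval q)
    refine (L.implements_loop (T := p.cost.eval q * U) i b hd (hq b) hqM
      (fun M e hM he => p.bounded_run hq hM he) fun M' hM' hM'' => ?_).mono ?_
    · exact (hp (fun b => (hd b).trans d.lt_succ_self) hM').mono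
        (Nat.mul_le_mul_left _ (unitCost_mono hM''))
    · rw [add_mul, mul_assoc, add_mul]
      gcongr
      exact hq b

end Layout

/-! ### Running times in terms of the input size -/

theorem length_le_inputSize (x : List ℕ) : x.length ≤ inputSize x :=
  (List.length_map (f := len) (as := x)).symm.trans_le
    (List.length_le_sum_of_one_le _ (by simp [one_le_len]))

theorem le_two_pow_inputSize {x : List ℕ} {a : ℕ} (ha : a ∈ x) : a ≤ 2 ^ inputSize x := by
  have hlen : len a ≤ inputSize x := List.single_le_sum (by simp) _ (List.mem_map_of_mem ha)
  exact (Nat.lt_size_self a).le.trans (Nat.pow_le_pow_right two_pos (by unfold len at hlen; omega))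

theorem unitCost_two_pow_le (N K : ℕ) : unitCost (2 ^ N + K) ≤ N + K + 6 := by
  have hK : K + 1 < 2 ^ (K + 1) := Nat.lt_two_pow_self
  have h : 2 ^ N + K + 1 ≤ 2 ^ N * 2 ^ (K + 1) := by
    have := Nat.one_le_two_pow (n := N)
    nlinarith
  refine Nat.succ_le_succ (Nat.size_le.2 ?_)
  calc 8 * (2 ^ N + K) + 8 ≤ 2 ^ N * 2 ^ (K + 1) * 2 ^ 3 := by omega
    _ < 2 ^ (N + K + 5) := by
      rw [← pow_add, ← pow_add]
      exact Nat.pow_lt_pow_right one_lt_two (by omega)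

theorem PolyTimeSolvableOn.mono {α : Type*} {encode : α → List ℕ} {IsAnswer : α → List ℕ → Prop}
    {S S' : Set α} (h : PolyTimeSolvableOn encode IsAnswer S') (hS : S ⊆ S') :
    PolyTimeSolvableOn encode IsAnswer S :=
  let ⟨P, b, hP⟩ := h
  ⟨P, b, fun a ha => hP a (hS ha)⟩

end RAM

/-! ### The greedy algorithm for matchable sets -/

section Greedy

variable {ι α : Type*}

/-- The elements of `A` can be matched injectively with neighbors, where `N c` is the set of
neighbors of `c`. The matchable sets are the independent sets of a transversal matroid. -/
def Matchable (N : ι → Finset α) (A : Finset ι) : Prop :=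
  ∃ g : A → α, Function.Injective g ∧ ∀ c : A, g c ∈ N c

theorem Matchable.mono {N : ι → Finset α} {A B : Finset ι} (h : Matchable N B) (hAB : A ⊆ B) :
    Matchable N A := by
  obtain ⟨g, hg, hN⟩ := h
  exact ⟨g ∘ Set.inclusion hAB, hg.comp (Set.inclusion_injective hAB),
    fun c => hN ⟨c, hAB c.2⟩⟩

theorem matchable_empty (N : ι → Finset α) : Matchable N ∅ :=
  ⟨fun c => absurd c.2 (Finset.notMem_empty _), fun c => absurd c.2 (Finset.notMem_empty _),
    fun c => absurd c.2 (Finset.notMem_empty _)⟩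

theorem Matchable.card_le [DecidableEq α] {N : ι → Finset α} {A : Finset ι} (h : Matchable N A) :
    A.card ≤ (A.biUnion N).card := by
  obtain ⟨g, hg, hN⟩ := h
  rw [← Finset.card_attach]
  exact Finset.card_le_card_of_injOn g
    (fun c _ => Finset.mem_biUnion.mpr ⟨c, c.2, hN c⟩) hg.injOn

theorem matchable_of_forall_card_le [DecidableEq α] {N : ι → Finset α} {A : Finset ι}
    (h : ∀ X ⊆ A, X.card ≤ (X.biUnion N).card) : Matchable N A := by
  classical
  refine (Finset.all_card_le_biUnion_card_iff_exists_injective fun c : A => N c).mp fun X => ?_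
  have := h (X.map (.subtype _)) (Finset.map_subtype_subset X)
  rwa [Finset.card_map, Finset.map_eq_image, Finset.image_biUnion] at this

/-- By Hall's theorem, sets that block the insertion of new elements into a matchable set `A`: all
the neighbors of `X` are needed for the elements of `X ∩ A`. -/
def IsTight [DecidableEq ι] [DecidableEq α] (N : ι → Finset α) (A X : Finset ι) : Prop :=
  (X.biUnion N).card ≤ (X ∩ A).card

section Tight

variable [DecidableEq ι] [DecidableEq α] {N : ι → Finset α} {A X Y : Finset ι}

theorem IsTight.union (hA : Matchable N A) (hX : IsTight N A X) (hY : IsTight N A Y) :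
    IsTight N A (X ∪ Y) := by
  unfold IsTight at *
  have hXY : ((X ∩ A) ∩ (Y ∩ A)).card ≤ (X.biUnion N ∩ Y.biUnion N).card :=
    (hA.mono (Finset.inter_subset_left.trans Finset.inter_subset_right)).card_le.trans <|
      Finset.card_le_card <| Finset.subset_inter
        (Finset.biUnion_subset_biUnion_of_subset_left N
          (Finset.inter_subset_left.trans Finset.inter_subset_left))
        (Finset.biUnion_subset_biUnion_of_subset_left N
          (Finset.inter_subset_right.trans Finset.inter_subset_left))
  have := Finset.card_union_add_card_inter (X.biUnion N) (Y.biUnion N)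
  have := Finset.card_union_add_card_inter (X ∩ A) (Y ∩ A)
  rw [Finset.union_biUnion, Finset.union_inter_distrib_right]
  omega

theorem Matchable.exists_isTight {c : ι} (hA : Matchable N A)
    (hc : ¬ Matchable N (insert c A)) : ∃ X, c ∈ X ∧ IsTight N A X := by
  unfold IsTight
  contrapose! hc
  refine matchable_of_forall_card_le fun X hX => ?_
  by_cases hcX : c ∈ X
  · have hXA : X ⊆ insert c (X ∩ A) := by
      rw [Finset.insert_inter_distrib, Finset.insert_eq_of_mem hcX]
      exact Finset.subset_inter subset_rfl hX
    exact (Finset.card_le_card hXA).trans ((Finset.card_insert_le _ _).trans (hc X hcX))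
  · exact (hA.mono ((Finset.subset_insert_iff_of_notMem hcX).mp hX)).card_le

theorem Matchable.exists_isTight_superset {Q : Finset ι} (hA : Matchable N A)
    (hQ : ∀ c ∈ Q, ¬ Matchable N (insert c A)) : ∃ X, Q ⊆ X ∧ IsTight N A X := by
  induction Q using Finset.induction with
  | empty => exact ⟨∅, subset_rfl, by simp [IsTight]⟩
  | insert c Q _ ih =>
    rw [Finset.forall_mem_insert] at hQ
    obtain ⟨X, hcX, hX⟩ := hA.exists_isTight hQ.1
    obtain ⟨Y, hQY, hY⟩ := ih hQ.2
    exact ⟨X ∪ Y, Finset.insert_subset (Finset.mem_union_left _ hcX)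
      (hQY.trans Finset.subset_union_right), hX.union hA hY⟩

end Tight

theorem Matchable.card_le_of_maximal [DecidableEq ι] {N : ι → Finset α} {A B P : Finset ι}
    (hA : Matchable N A) (hB : Matchable N B) (hBP : B ⊆ P)
    (hmax : ∀ c ∈ P \ A, ¬ Matchable N (insert c A)) : B.card ≤ A.card := by
  classical
  obtain ⟨X, hPX, hX⟩ := hA.exists_isTight_superset hmax
  have h_inter : (B ∩ X).card ≤ (A ∩ X).card := by
    rw [Finset.inter_comm A X]
    exact (hB.mono Finset.inter_subset_left).card_le.trans <| (Finset.card_le_card <|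
      Finset.biUnion_subset_biUnion_of_subset_left N Finset.inter_subset_right).trans hX
  have h_sdiff : B \ X ⊆ A \ X := fun c hc => by
    rw [Finset.mem_sdiff] at hc ⊢
    exact ⟨by_contra fun hcA => hc.2 (hPX (Finset.mem_sdiff.mpr ⟨hBP hc.1, hcA⟩)), hc.2⟩
  have := Finset.card_le_card h_sdiff
  have := Finset.card_inter_add_card_sdiff B X
  have := Finset.card_inter_add_card_sdiff A X
  omega

theorem sum_eq_sum_card_filter_lt (w : ι → ℕ) (A : Finset ι) {T : ℕ} (hT : ∀ c ∈ A, w c ≤ T) :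
    ∑ c ∈ A, w c = ∑ t ∈ Finset.range T, (A.filter (t < w ·)).card := by
  simp only [Finset.card_filter]
  rw [Finset.sum_comm]
  refine Finset.sum_congr rfl fun c hc => ?_
  have : (Finset.range T).filter (· < w c) = Finset.range (w c) := by
    ext t
    have := hT c hc
    simp only [Finset.mem_filter, Finset.mem_range]
    omega
  rw [← Finset.card_filter, this, Finset.card_range]

theorem sum_le_sum_of_card_filter_le {w : ι → ℕ} {A B : Finset ι} (hcard : A.card ≤ B.card)
    (h : ∀ t, (B.filter (w · ≤ t)).card ≤ (A.filter (w · ≤ t)).card) :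
    ∑ c ∈ A, w c ≤ ∑ c ∈ B, w c := by
  have hA : ∀ c ∈ A, w c ≤ max (A.sup w) (B.sup w) := fun c hc =>
    (Finset.le_sup hc).trans (le_max_left _ _)
  have hB : ∀ c ∈ B, w c ≤ max (A.sup w) (B.sup w) := fun c hc =>
    (Finset.le_sup hc).trans (le_max_right _ _)
  rw [sum_eq_sum_card_filter_lt w A hA, sum_eq_sum_card_filter_lt w B hB]
  refine Finset.sum_le_sum fun t _ => ?_
  have hAt := Finset.card_filter_add_card_filter_not (s := A) (w · ≤ t)
  have hBt := Finset.card_filter_add_card_filter_not (s := B) (w · ≤ t)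
  simp only [not_le] at hAt hBt
  have := h t
  omega

variable [DecidableEq ι]

/-- `A` is a possible result of the greedy algorithm for matchable subsets of `P`, which considers
the elements in the order of increasing weights. -/
structure IsGreedy (N : ι → Finset α) (w : ι → ℕ) (P A : Finset ι) : Prop where
  matchable : Matchable N A
  subset : A ⊆ P
  rejected : ∀ c ∈ P, c ∉ A → ¬ Matchable N (insert c (A.filter (w · ≤ w c)))

namespace IsGreedy

variable {N : ι → Finset α} {w : ι → ℕ} {P A : Finset ι}

theorem empty (N : ι → Finset α) (w : ι → ℕ) : IsGreedy N w ∅ ∅ :=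
  ⟨matchable_empty N, subset_rfl, by simp⟩

theorem accept {c : ι} (h : IsGreedy N w P A) (hc : Matchable N (insert c A)) :
    IsGreedy N w (insert c P) (insert c A) := by
  refine ⟨hc, Finset.insert_subset_insert _ h.subset, fun d hd hdA hm => ?_⟩
  rw [Finset.mem_insert, not_or] at hdA
  refine h.rejected d (Finset.mem_of_mem_insert_of_ne hd hdA.1) hdA.2 (hm.mono ?_)
  exact Finset.insert_subset_insert _ (Finset.filter_subset_filter _ (Finset.subset_insert _ _))

theorem reject {c : ι} (h : IsGreedy N w P A) (hw : ∀ d ∈ P, w d ≤ w c)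
    (hc : ¬ Matchable N (insert c A)) : IsGreedy N w (insert c P) A := by
  refine ⟨h.matchable, h.subset.trans (Finset.subset_insert _ _), fun d hd hdA => ?_⟩
  rcases Finset.mem_insert.mp hd with rfl | hd
  · rwa [Finset.filter_true_of_mem fun d hd => hw d (h.subset hd)]
  · exact h.rejected d hd hdA

variable {B : Finset ι}

theorem card_filter_le (h : IsGreedy N w P A) (hB : Matchable N B) (hBP : B ⊆ P) (t : ℕ) :
    (B.filter (w · ≤ t)).card ≤ (A.filter (w · ≤ t)).card := by
  refine Matchable.card_le_of_maximal (P := P.filter (w · ≤ t))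
    (h.matchable.mono (Finset.filter_subset _ _)) (hB.mono (Finset.filter_subset _ _))
    (Finset.filter_subset_filter _ hBP) fun c hc hm => ?_
  simp only [Finset.mem_sdiff, Finset.mem_filter, not_and] at hc
  obtain ⟨⟨hcP, hct⟩, hcA⟩ := hc
  refine h.rejected c hcP (fun h => hcA h hct) (hm.mono (Finset.insert_subset_insert _ ?_))
  exact Finset.monotone_filter_right _ fun d _ hd => hd.trans hct

theorem card_le (h : IsGreedy N w P A) (hB : Matchable N B) (hBP : B ⊆ P) :
    B.card ≤ A.card := by
  refine h.matchable.card_le_of_maximal hB hBP fun c hc hm => ?_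
  obtain ⟨hcP, hcA⟩ := Finset.mem_sdiff.mp hc
  exact h.rejected c hcP hcA (hm.mono (Finset.insert_subset_insert _ (Finset.filter_subset _ _)))

theorem sum_le (h : IsGreedy N w P A) (hB : Matchable N B) (hBP : B ⊆ P)
    (hcard : A.card ≤ B.card) : ∑ c ∈ A, w c ≤ ∑ c ∈ B, w c :=
  sum_le_sum_of_card_filter_le hcard (h.card_filter_le hB hBP)

end IsGreedy

end Greedy

/-! ### Matching by an auction -/

section Auction

variable {ι α : Type*}

/-- The function `f` gives one item of `T` to each element of `S`; the other items are owned by the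
dummy `o`. -/
def IsAssignment (T : Finset α) (o : ι) (S : Finset ι) (f : α → ι) : Prop :=
  Set.BijOn f {v | v ∈ T ∧ f v ≠ o} S

namespace IsAssignment

variable {T : Finset α} {o h : ι} {S : Finset ι} {f g : α → ι} {b z : α}

theorem congr (hf : IsAssignment T o S f) (hfg : ∀ v ∈ T, g v = f v) : IsAssignment T o S g := by
  have hT : {v | v ∈ T ∧ g v ≠ o} = {v | v ∈ T ∧ f v ≠ o} :=
    Set.ext fun v => and_congr_right fun hv => by rw [hfg v hv]
  rw [IsAssignment, hT]
  exact Set.BijOn.congr hf fun v hv => (hfg v hv.1).symm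

variable [DecidableEq α]

theorem insert_iff (hz : f z = o) : IsAssignment (insert z T) o S f ↔ IsAssignment T o S f := by
  have : {v | v ∈ insert z T ∧ f v ≠ o} = {v | v ∈ T ∧ f v ≠ o} := by
    ext v
    simp only [Finset.mem_insert, Set.mem_ofPred_eq]
    refine and_congr_left fun hv => or_iff_right ?_
    rintro rfl
    exact hv hz
  rw [IsAssignment, this, IsAssignment]

theorem update [DecidableEq ι] (hf : IsAssignment T o (S.erase h) f) (hS : h ∈ S) (ho : o ∉ S)
    (hb : b ∈ T) : IsAssignment T o (S.erase (f b)) (Function.update f b h) := by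
  obtain ⟨hmaps, hinj, hsurj⟩ := hf
  have hho : h ≠ o := ne_of_mem_of_not_mem hS ho
  have hmem : ∀ v ∈ T, f v ≠ o → f v ≠ h ∧ f v ∈ S := fun v hv hvo =>
    Finset.mem_erase.mp (hmaps ⟨hv, hvo⟩)
  have hne : ∀ v ∈ T, f v ≠ h := fun v hv hvh => (hmem v hv (hvh ▸ hho)).1 hvh
  refine ⟨fun v ⟨hv, hvo⟩ => ?_, fun u ⟨hu, huo⟩ v ⟨hv, hvo⟩ huv => ?_, fun c hc => ?_⟩
  · rw [Finset.mem_coe, Finset.mem_erase]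
    rcases eq_or_ne v b with rfl | hvb
    · rw [Function.update_self]
      exact ⟨(hne v hb).symm, hS⟩
    · rw [Function.update_of_ne hvb] at hvo ⊢
      exact ⟨fun h => hvb (hinj ⟨hv, hvo⟩ ⟨hb, h ▸ hvo⟩ h), (hmem v hv hvo).2⟩
  · rw [Function.update_apply] at huo hvo huv
    rw [Function.update_apply] at huv
    split_ifs at huo hvo huv with hub hvb hvb
    · rw [hub, hvb]
    · exact absurd huv.symm (hne v hv)
    · exact absurd huv (hne u hu)
    · exact hinj ⟨hu, huo⟩ ⟨hv, hvo⟩ huv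
  · obtain ⟨hcb, hcS⟩ := Finset.mem_erase.mp hc
    rcases eq_or_ne c h with rfl | hch
    · exact ⟨b, ⟨hb, by rwa [Function.update_self]⟩, Function.update_self ..⟩
    · obtain ⟨v, ⟨hv, hvo⟩, rfl⟩ := hsurj (Finset.mem_coe.mpr (Finset.mem_erase.mpr ⟨hch, hcS⟩))
      have hvb : v ≠ b := fun h => hcb (congrArg f h)
      exact ⟨v, ⟨hv, by rwa [Function.update_of_ne hvb]⟩, Function.update_of_ne hvb ..⟩

end IsAssignment

/-- An assignment in which the elements of `A` get neighbors. -/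
structure IsMatching (N : ι → Finset α) (V : Finset α) (o : ι) (A : Finset ι) (f : α → ι) :
    Prop where
  isAssignment : IsAssignment V o A f
  mem : ∀ v ∈ V, f v ≠ o → v ∈ N (f v)

namespace IsMatching

variable {N : ι → Finset α} {V : Finset α} {o : ι} {A : Finset ι} {f g : α → ι}

theorem empty (hf : ∀ v ∈ V, f v = o) : IsMatching N V o ∅ f := by
  refine ⟨?_, fun v hv hvo => absurd (hf v hv) hvo⟩
  have : {v | v ∈ V ∧ f v ≠ o} = ∅ :=
    Set.eq_empty_of_forall_notMem fun v hv => hv.2 (hf v hv.1)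
  rw [IsAssignment, this, Finset.coe_empty]
  exact Set.bijOn_empty f

theorem congr (h : IsMatching N V o A f) (hfg : ∀ v ∈ V, g v = f v) : IsMatching N V o A g :=
  ⟨h.isAssignment.congr hfg, fun v hv => hfg v hv ▸ h.mem v hv⟩

theorem notMem (h : IsMatching N V o A f) : o ∉ A := fun ho =>
  let ⟨_, hv, hvo⟩ := h.isAssignment.surjOn ho
  hv.2 hvo

theorem card_lt {v : α} (h : IsMatching N V o A f) (hv : v ∈ V) (hvo : f v = o) :
    A.card < V.card := by
  classical
  have hA : A ⊆ (V.erase v).image f := fun c hc => by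
    obtain ⟨u, ⟨hu, huo⟩, rfl⟩ := h.isAssignment.surjOn hc
    exact Finset.mem_image_of_mem f (Finset.mem_erase.mpr ⟨fun huv => huo (huv ▸ hvo), hu⟩)
  exact ((Finset.card_le_card hA).trans Finset.card_image_le).trans_lt
    (Finset.card_erase_lt_of_mem hv)

theorem matchable (h : IsMatching N V o A f) : Matchable N A := by
  have hA : ∀ c : A, ∃ v, (v ∈ V ∧ f v ≠ o) ∧ f v = c := fun c => h.isAssignment.surjOn c.2
  choose g hg hfg using hA
  refine ⟨g, fun c d hcd => Subtype.ext (by rw [← hfg c, ← hfg d, hcd]), fun c => ?_⟩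
  have := h.mem (g c) (hg c).1 (hg c).2
  rwa [hfg c] at this

end IsMatching

variable [DecidableEq ι] [DecidableEq α]

/-- The state of an auction after `k` bids. The bidders in `S` compete for the items in `V` and the
reserve item `z`, which everybody accepts; `f` and `p` are the owners and the prices, and `h` is the
bidder without an item, or `o` if there is none. The reserve item is sold last, because its price is
`V.card + 1` until then. -/
structure IsAuction (N : ι → Finset α) (V : Finset α) (z : α) (o : ι) (S : Finset ι) (k : ℕ)
    (f : α → ι) (p : α → ℕ) (h : ι) : Prop where
  isAssignment : IsAssignment (insert z V) o (S.erase h) f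
  mem : ∀ v ∈ V, f v ≠ o → v ∈ N (f v)
  hand : h ≠ o → h ∈ S
  notMem : o ∉ S
  reserve_free : h ≠ o → f z = o ∧ p z = V.card + 1
  reserve_sold : f z ≠ o → p z = V.card + 2
  price_free : ∀ v ∈ V, f v = o → p v = 0
  slack : ∀ v ∈ insert z V, f v ≠ o → ∀ u ∈ N (f v), p v ≤ p u + 1
  price_le : ∀ v ∈ V, p v ≤ V.card + 2
  sum_price : h ≠ o → ∑ v ∈ V, p v = k

namespace IsAuction

variable {N : ι → Finset α} {V : Finset α} {z : α} {o h : ι} {S A : Finset ι} {k : ℕ} {f : α → ι}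
  {p : α → ℕ}

theorem start {c : ι} (hf : IsMatching N V o A f) (hc : c ≠ o) (hcA : c ∉ A) (hz : f z = o)
    (hp : ∀ v ∈ V, p v = 0) (hpz : p z = V.card + 1) : IsAuction N V z o (insert c A) 0 f p c where
  isAssignment := by
    rw [Finset.erase_insert hcA, IsAssignment.insert_iff hz]
    exact hf.isAssignment
  mem := hf.mem
  hand _ := Finset.mem_insert_self _ _
  notMem ho := (Finset.mem_insert.mp ho).elim hc.symm hf.notMem
  reserve_free _ := ⟨hz, hpz⟩
  reserve_sold hzo := absurd hz hzo
  price_free v hv _ := hp v hv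
  slack v hv hvo u _ := by
    rcases Finset.mem_insert.mp hv with rfl | hv
    · exact absurd hz hvo
    · simp [hp v hv]
  price_le v hv := by simp [hp v hv]
  sum_price _ := Finset.sum_eq_zero hp

theorem slack_update {b : α} {c : ι} (ha : IsAuction N V z o S k f p h)
    (hmin : ∀ u ∈ N c, p b ≤ p u) {v : α} (hv : v ∈ insert z V)
    (hvo : Function.update f b c v ≠ o) {u : α} (hu : u ∈ N (Function.update f b c v)) :
    Function.update p b (p b + 1) v ≤ Function.update p b (p b + 1) u + 1 := by
  have hpu : p u ≤ Function.update p b (p b + 1) u := by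
    rcases eq_or_ne u b with rfl | hub
    · rw [Function.update_self]
      exact Nat.le_succ _
    · rw [Function.update_of_ne hub]
  rcases eq_or_ne v b with rfl | hvb
  · rw [Function.update_self] at hu ⊢
    have := hmin u hu
    omega
  · rw [Function.update_of_ne hvb] at hu hvo ⊢
    have := ha.slack v hv hvo u hu
    omega

theorem bid {b : α} (ha : IsAuction N V z o S k f p h) (hh : h ≠ o) (hz : z ∉ V)
    (hb : b = z ∨ b ∈ V ∧ b ∈ N h) (hbz : p b ≤ p z) (hmin : ∀ u ∈ N h, p b ≤ p u) :
    IsAuction N V z o S (k + 1) (Function.update f b h) (Function.update p b (p b + 1)) (f b) where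
  isAssignment := ha.isAssignment.update (ha.hand hh) ha.notMem
    (Finset.mem_insert.mpr (hb.imp_right And.left))
  mem v hv hvo := by
    rcases eq_or_ne v b with rfl | hvb
    · rw [Function.update_self]
      exact (hb.resolve_left (ne_of_mem_of_not_mem hv hz)).2
    · rw [Function.update_of_ne hvb] at hvo ⊢
      exact ha.mem v hv hvo
  hand hbo := by
    have hbT : b ∈ insert z V := Finset.mem_insert.mpr (hb.imp_right And.left)
    exact Finset.mem_of_mem_erase (ha.isAssignment.mapsTo ⟨hbT, hbo⟩)
  notMem := ha.notMem
  reserve_free hbo := by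
    have hzb : z ≠ b := fun hzb => hbo (hzb ▸ (ha.reserve_free hh).1)
    rw [Function.update_of_ne hzb, Function.update_of_ne hzb]
    exact ha.reserve_free hh
  reserve_sold := by
    rcases eq_or_ne z b with rfl | hzb
    · rw [Function.update_self, Function.update_self, (ha.reserve_free hh).2]
      exact fun _ => rfl
    · rw [Function.update_of_ne hzb, Function.update_of_ne hzb]
      exact ha.reserve_sold
  price_free v hv := by
    rcases eq_or_ne v b with rfl | hvb
    · rw [Function.update_self]
      exact fun hho => absurd hho hh
    · rw [Function.update_of_ne hvb, Function.update_of_ne hvb]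
      exact ha.price_free v hv
  slack _ hv hvo _ hu := ha.slack_update hmin hv hvo hu
  price_le v hv := by
    have := (ha.reserve_free hh).2
    rw [Function.update_apply]
    split_ifs
    exacts [by omega, ha.price_le v hv]
  sum_price hbo := by
    have hbV : b ∈ V := (hb.resolve_left fun hbz => hbo (hbz ▸ (ha.reserve_free hh).1)).1
    have hsum := ha.sum_price hh
    rw [← Finset.add_sum_erase _ _ hbV] at hsum
    rw [Finset.sum_update_of_mem hbV, Finset.sdiff_singleton_eq_erase]
    omega

theorem idle (ha : IsAuction N V z o S k f p o) : IsAuction N V z o S (k + 1) f p o :=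
  { ha with sum_price := fun ho => absurd rfl ho }

theorem hand_eq_none (ha : IsAuction N V z o S k f p h) (hk : V.card * (V.card + 2) < k) :
    h = o := by
  by_contra hh
  have hsum := Finset.sum_le_card_nsmul V p _ ha.price_le
  rw [ha.sum_price hh, smul_eq_mul] at hsum
  omega

theorem isMatching (ha : IsAuction N V z o S k f p o) (hz : f z = o) : IsMatching N V o S f where
  isAssignment := by
    rw [← IsAssignment.insert_iff hz, ← Finset.erase_eq_of_notMem ha.notMem]
    exact ha.isAssignment
  mem := ha.mem

theorem neighbors_subset {l : ℕ} (ha : IsAuction N V z o S k f p h) (hN : ∀ c, N c ⊆ V)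
    (hl : ∀ v ∈ V, p v ≠ l) {v : α} (hv : v ∈ insert z V) (hvo : f v ≠ o) (hlv : l < p v) :
    N (f v) ⊆ V.filter (l < p ·) := fun u hu => by
  have := ha.slack v hv hvo u hu
  have := hl u (hN _ hu)
  exact Finset.mem_filter.mpr ⟨hN _ hu, by omega⟩

/-- The owners of the items above a gap in the prices violate Hall's condition: by the slackness
condition all their neighbors are above the gap, and they also own the reserve item. -/
theorem not_matchable_of_gap {l : ℕ} (ha : IsAuction N V z o S k f p h) (hN : ∀ c, N c ⊆ V)
    (hz : z ∉ V) (hzo : f z ≠ o) (hl : ∀ v ∈ V, p v ≠ l) (hlz : l < p z) : ¬ Matchable N S := by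
  intro hS
  set Y := V.filter (l < p ·)
  have hsold : ∀ v ∈ insert z Y, v ∈ insert z V ∧ f v ≠ o := by
    rw [Finset.forall_mem_insert]
    refine ⟨⟨Finset.mem_insert_self _ _, hzo⟩, fun v hv => ?_⟩
    obtain ⟨hvV, hlv⟩ := Finset.mem_filter.mp hv
    exact ⟨Finset.mem_insert_of_mem hvV, fun hvo => by have := ha.price_free v hvV hvo; omega⟩
  have hprice : ∀ v ∈ insert z Y, l < p v :=
    Finset.forall_mem_insert .. |>.mpr ⟨hlz, fun v hv => (Finset.mem_filter.mp hv).2⟩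
  have hcard : ((insert z Y).image f).card = Y.card + 1 := by
    rw [Finset.card_image_of_injOn fun u hu v hv => ha.isAssignment.injOn (hsold u hu) (hsold v hv),
      Finset.card_insert_of_notMem fun hzY => hz (Finset.mem_filter.mp hzY).1]
  have hsub : (insert z Y).image f ⊆ S := Finset.image_subset_iff.mpr fun v hv =>
    Finset.mem_of_mem_erase (ha.isAssignment.mapsTo (hsold v hv))
  have hnbr : ((insert z Y).image f).biUnion N ⊆ Y := by
    rw [Finset.image_biUnion]
    exact Finset.biUnion_subset.mpr fun v hv =>
      ha.neighbors_subset hN hl (hsold v hv).1 (hsold v hv).2 (hprice v hv)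
  have := (hS.mono hsub).card_le
  have := Finset.card_le_card hnbr
  omega

theorem not_matchable (ha : IsAuction N V z o S k f p h) (hN : ∀ c, N c ⊆ V) (hz : z ∉ V)
    (hzo : f z ≠ o) : ¬ Matchable N S := by
  obtain ⟨l, hl, hlp⟩ : ∃ l ∈ Finset.Icc 1 (V.card + 1), l ∉ V.image p := by
    refine Finset.exists_mem_notMem_of_card_lt_card (Finset.card_image_le.trans_lt ?_)
    simp
  have := ha.reserve_sold hzo
  refine ha.not_matchable_of_gap hN hz hzo (l := l) (fun v hv hpv => ?_) ?_
  · exact hlp (Finset.mem_image.mpr ⟨v, hv, hpv⟩)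
  · have := (Finset.mem_Icc.mp hl).2
    omega

end IsAuction

end Auction

/-! ### The program -/

namespace WLCP

open RAM LoopProg Op

/-- The variables of the program. -/
inductive Var
  | i | j | r | s | k | t | u | pos | cap | color | bidder | best | failed
  deriving DecidableEq

/-- The arrays of the program: the incidence matrix of the lists, the sort keys of the colors, the
current matching, and the owners and the prices in the current auction. -/
inductive Arr
  | lists | keys | matching | owner | price
  deriving DecidableEq

/-- The loop bounds of the program. -/
inductive Bound
  | vertices | colors | rounds

/-- The values of the loop bounds for `n` vertices and `m` colors. -/
def bounds (n m : ℕ) : Bound → ℕ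
  | .vertices => n
  | .colors => m
  | .rounds => n + 2

/-- A piece of the program. -/
abbrev Code := LoopProg Var Arr Bound

/-- Skip the adjacency matrix. -/
def skipGraph : Code := loop .i .vertices (loop .j .vertices (op (read .t)))

/-- Read the incidence matrix of the lists. -/
def readLists : Code :=
  chain [op (const .pos 0),
    loop .i .vertices (loop .j .colors (chain [op (read .t), op (set .lists .pos .t),
      op (inc .pos .pos)]))]

/-- Use the weights as sort keys, and compute a number `cap` larger than all of them. -/
def readWeights : Code :=
  chain [op (const .cap 0),
    loop .i .colors (chain [op (read .t), op (set .keys .i .t),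
      ifLt .cap .t (op (copy .cap .t)) skip]),
    op (inc .cap .cap)]

/-- Start with the empty matching: the number of colors plays the role of a missing color. -/
def clearMatching : Code :=
  chain [op (bound .t .colors), loop .i .vertices (op (set .matching .i .t))]

/-- Replace `color` by `i` if the key of `i` is smaller. -/
def compareColor : Code :=
  chain [op (get .t .keys .i), op (get .u .keys .color), ifLt .t .u (op (copy .color .i)) skip]

/-- Find a color with the least key. -/
def selectColor : Code := chain [op (const .color 0), loop .i .colors compareColor]

/-- Let the items of the auction be the vertices with their current matching, at price `0`. -/
def resetItems : Code :=
  chain [op (const .t 0),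
    loop .i .vertices (chain [op (get .u .matching .i), op (set .owner .i .u),
      op (set .price .i .t)])]

/-- Let the number of vertices be the reserve item. -/
def resetReserve : Code :=
  chain [op (bound .t .vertices), op (bound .u .colors), op (set .owner .t .u), op (inc .u .t),
    op (set .price .t .u)]

/-- Start an auction whose first bidder is the selected color. -/
def startAuction : Code := chain [resetItems, resetReserve, op (copy .bidder .color)]

/-- Replace `best` by the vertex `i` if the bidder accepts `i` and it is cheaper. -/
def compareVertex : Code :=
  chain [op (get .t .lists .pos), op (const .u 0),
    ifLt .u .t (chain [op (get .t .price .i), op (get .u .price .best),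
      ifLt .t .u (op (copy .best .i)) skip]) skip]

/-- Move `pos` to the next row of the incidence matrix. -/
def nextRow : Code := loop .j .colors (op (inc .pos .pos))

/-- Find a cheapest item for the bidder. -/
def findVertex : Code :=
  chain [op (bound .best .vertices), op (copy .pos .bidder),
    loop .i .vertices (chain [compareVertex, nextRow])]

/-- Hand the item over to the bidder, and make its previous owner the next bidder. -/
def place : Code :=
  chain [op (get .t .owner .best), op (set .owner .best .bidder), op (get .u .price .best),
    op (inc .u .u), op (set .price .best .u), op (copy .bidder .t)]

/-- One bid, if there is a bidder. -/
def bid : Code := chain [op (bound .t .colors), ifLt .bidder .t (chain [findVertex, place]) skip]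

/-- Enough bids to complete the auction. -/
def auction : Code := loop .r .rounds (loop .s .rounds bid)

/-- Replace the current matching by the result of the auction. -/
def copyOwners : Code :=
  loop .i .vertices (chain [op (get .t .owner .i), op (set .matching .i .t)])

/-- Keep the result of the auction if the reserve item has not been sold. -/
def commit : Code :=
  chain [op (bound .t .vertices), op (get .t .owner .t), op (bound .u .colors),
    ifLt .t .u skip copyOwners]

/-- Consider one more color; its key is set to `cap`, so that it is not selected again. -/
def phase : Code :=
  chain [selectColor, op (set .keys .color .cap), startAuction, auction, commit]

/-- Set `failed` to `1` if some vertex is unmatched and to `0` otherwise. -/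
def checkMatching : Code :=
  chain [op (const .failed 0), op (bound .u .colors),
    loop .i .vertices (chain [op (get .t .matching .i), ifLt .t .u skip (op (const .failed 1))])]

/-- Print the matching. -/
def printMatching : Code :=
  chain [op (const .t 1), op (print .t),
    loop .i .vertices (chain [op (get .t .matching .i), op (print .t)])]

/-- Print the answer. -/
def output : Code :=
  chain [checkMatching, op (const .t 0), ifLt .t .failed (op (print .t)) printMatching]

/-- The preparations for the greedy algorithm. -/
def input : Code := chain [skipGraph, readLists, readWeights, clearMatching]

/-- The program for the list coloring problem. -/
def program : Code := chain [input, loop .k .colors phase, output]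

section Input

variable (n m : ℕ) (e : Store Var Arr)

theorem skipGraph_inp : (skipGraph.run (bounds n m) e).inp = e.inp.drop (n * n) := by
  refine run_loop_induction (bounds n m) (fun k e' => e'.inp = e.inp.drop (k * n)) (by simp)
    fun k e' _ _ he' => ?_
  rw [Nat.succ_mul]
  exact run_loop_induction (bounds n m) (fun l e' => e'.inp = e.inp.drop (k * n + l)) he'
    fun l e' _ _ he' => by simp [Op.run, he', Nat.add_assoc]

theorem readLists_spec :
    (readLists.run (bounds n m) e).inp = e.inp.drop (n * m) ∧
      ∀ i < n * m, (readLists.run (bounds n m) e).arr .lists i = e.inp.getD i 0 := by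
  let I (q : ℕ) (e' : Store Var Arr) : Prop :=
    e'.var .pos = q ∧ e'.inp = e.inp.drop q ∧ ∀ i < q, e'.arr .lists i = e.inp.getD i 0
  suffices I (n * m) (readLists.run (bounds n m) e) from this.2
  refine run_loop_induction (bounds n m) (fun k e' => I (k * m) e') (by simp [I, Op.run])
    fun k e' _ _ he' => ?_
  rw [Nat.succ_mul]
  refine run_loop_induction (bounds n m) (fun l e' => I (k * m + l) e') he'
    fun l e' _ _ ⟨hpos, hinp, hlists⟩ => ⟨by simp [Op.run, hpos, Nat.add_assoc],
      by simp [Op.run, hinp, Nat.add_assoc], fun i hi => ?_⟩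
  rcases (Nat.le_of_lt_succ hi).lt_or_eq with hi | rfl
  · have : i ≠ k * m + l := hi.ne
    simpa [Op.run, hpos, this] using hlists i hi
  · simp [Op.run, hpos, hinp]

theorem readWeights_spec {c : ℕ} (hc : c < m) :
    (readWeights.run (bounds n m) e).arr .keys c = e.inp.getD c 0 ∧
      e.inp.getD c 0 < (readWeights.run (bounds n m) e).var .cap := by
  let I (k : ℕ) (e' : Store Var Arr) : Prop :=
    e'.inp = e.inp.drop k ∧ ∀ c < k, e'.arr .keys c = e.inp.getD c 0 ∧ e.inp.getD c 0 ≤ e'.var .cap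
  suffices I m _ by simpa [readWeights, Op.run, Nat.lt_succ_iff] using this.2 c hc
  refine run_loop_induction (bounds n m) I (by simp [I]) fun k e' _ _ ⟨hinp, hkeys⟩ => ?_
  have hread : e'.inp.headD 0 = e.inp.getD k 0 := by simp [hinp]
  simp only [run_chain_cons, run_chain_nil, run_op, run_ifLt, run_skip, Op.run, Store.setVar_inp,
    hread]
  generalize hx : e.inp.getD k 0 = x
  refine ⟨by split_ifs <;> simp [hinp], fun c hc => ?_⟩
  rcases (Nat.le_of_lt_succ hc).lt_or_eq with hc | rfl
  · obtain ⟨hkey, hcap⟩ := hkeys c hc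
    generalize e.inp.getD c 0 = y at *
    split_ifs with h <;> simp [hc.ne] at h ⊢ <;> omega
  · rw [hx]
    split_ifs with h <;> simp at h ⊢
    omega

theorem clearMatching_spec {v : ℕ} (hv : v < n) :
    (clearMatching.run (bounds n m) e).arr .matching v = m := by
  suffices ∀ v < n, (clearMatching.run (bounds n m) e).arr .matching v = m from this v hv
  refine run_loop_induction (bounds n m) (e := e.setVar .t m) (b := .vertices)
    (fun k (e' : Store Var Arr) => ∀ v < k, e'.arr .matching v = m) (by simp)
    fun k e' _ he he' v hv => ?_
  have ht : e'.var .t = m := by simpa using he.var .t (by decide)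
  rcases (Nat.le_of_lt_succ hv).lt_or_eq with hv | rfl
  · simpa [Op.run, hv.ne] using he' v hv
  · simp [Op.run, ht]

end Input

section Auction

variable {n m : ℕ} {e : Store Var Arr}

theorem resetItems_spec {v : ℕ} (hv : v < n) :
    (resetItems.run (bounds n m) e).arr .owner v = e.arr .matching v ∧
      (resetItems.run (bounds n m) e).arr .price v = 0 := by
  suffices ∀ v < n, (resetItems.run (bounds n m) e).arr .owner v = e.arr .matching v ∧
    (resetItems.run (bounds n m) e).arr .price v = 0 from this v hv
  refine run_loop_induction (bounds n m) (b := .vertices) (e := e.setVar .t 0)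
    (fun k (e' : Store Var Arr) =>
      ∀ v < k, e'.arr .owner v = e.arr .matching v ∧ e'.arr .price v = 0)
    (by simp) fun k e' _ he he' v hv => ?_
  have ht : e'.var .t = 0 := by simpa using he.var .t (by decide)
  have hmatching : e'.arr .matching = e.arr .matching := he.arr .matching (by decide)
  rcases (Nat.le_of_lt_succ hv).lt_or_eq with hv | rfl
  · simpa [Op.run, hv.ne] using he' v hv
  · simp [Op.run, ht, hmatching]

/-- The array `L` holds the incidence matrix of `N`. -/
structure IsIncidence (N : ℕ → Finset ℕ) (n m : ℕ) (L : ℕ → ℕ) : Prop where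
  subset : ∀ c, N c ⊆ Finset.range n
  mem_iff : ∀ v < n, ∀ c < m, v ∈ N c ↔ 0 < L (v * m + c)

theorem compareVertex_best : (compareVertex.run (bounds n m) e).var .best =
    if 0 < e.arr .lists (e.var .pos) ∧ e.arr .price (e.var .i) < e.arr .price (e.var .best)
      then e.var .i else e.var .best := by
  by_cases h : 0 < e.arr .lists (e.var .pos) <;>
  by_cases h' : e.arr .price (e.var .i) < e.arr .price (e.var .best) <;>
  simp [compareVertex, Op.run, h, h']

theorem nextRow_pos : (nextRow.run (bounds n m) e).var .pos = e.var .pos + m :=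
  run_loop_induction (bounds n m) (fun k (e' : Store Var Arr) => e'.var .pos = e.var .pos + k) rfl
    fun k e' _ _ he' => by simp [Op.run, he', Nat.add_assoc]

variable {N : ℕ → Finset ℕ}

/-- Among the vertices below `k` and the reserve item `n`, the item `b` is a cheapest one that `c`
accepts. -/
structure IsBestItem (N : ℕ → Finset ℕ) (n : ℕ) (p : ℕ → ℕ) (c k b : ℕ) : Prop where
  accepted : b = n ∨ b ∈ N c
  le_reserve : p b ≤ p n
  le : ∀ u < k, u ∈ N c → p b ≤ p u

theorem IsBestItem.reserve (N : ℕ → Finset ℕ) (n : ℕ) (p : ℕ → ℕ) (c : ℕ) :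
    IsBestItem N n p c 0 n := ⟨.inl rfl, le_rfl, by simp⟩

theorem IsBestItem.succ {p : ℕ → ℕ} {c k b : ℕ} (h : IsBestItem N n p c k b) :
    IsBestItem N n p c (k + 1) (if k ∈ N c ∧ p k < p b then k else b) := by
  split_ifs with hk
  · refine ⟨.inr hk.1, hk.2.le.trans h.le_reserve, fun u hu huN => ?_⟩
    rcases (Nat.le_of_lt_succ hu).lt_or_eq with hu | rfl
    exacts [hk.2.le.trans (h.le u hu huN), le_rfl]
  · refine ⟨h.accepted, h.le_reserve, fun u hu huN => ?_⟩
    rcases (Nat.le_of_lt_succ hu).lt_or_eq with hu | rfl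
    exacts [h.le u hu huN, not_lt.mp fun hlt => hk ⟨huN, hlt⟩]

theorem findVertex_isBestItem (hN : IsIncidence N n m (e.arr .lists)) (hm : e.var .bidder < m) :
    IsBestItem N n (e.arr .price) (e.var .bidder) n
      ((findVertex.run (bounds n m) e).var .best) := by
  let I (k : ℕ) (e' : Store Var Arr) : Prop := e'.var .pos = k * m + e.var .bidder ∧
    IsBestItem N n (e.arr .price) (e.var .bidder) k (e'.var .best)
  suffices I n (findVertex.run (bounds n m) e) from this.2
  refine run_loop_induction (bounds n m) (b := .vertices)
    (e := (chain [op (bound .best .vertices), op (copy .pos .bidder)] : Code).run (bounds n m) e) I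
    ⟨by simp [Op.run], .reserve ..⟩ fun k e' hk he ⟨hpos, hbest⟩ => ?_
  have hlists : e'.arr .lists = e.arr .lists := he.arr .lists (by decide)
  have hprice : e'.arr .price = e.arr .price := he.arr .price (by decide)
  let e₁ := compareVertex.run (bounds n m) (e'.setVar .i k)
  have hpos₁ : e₁.var .pos = k * m + e.var .bidder :=
    ((compareVertex.run_eqOff (bounds n m) _).var .pos (by decide)).trans hpos
  constructor
  · rw [Nat.succ_mul, Nat.add_right_comm, ← hpos₁]
    exact nextRow_pos
  · convert hbest.succ using 1
    refine ((nextRow.run_eqOff (bounds n m) e₁).var .best (by decide)).trans ?_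
    rw [compareVertex_best]
    simp [hlists, hprice, hpos, hN.mem_iff k hk _ hm]

variable {S A : Finset ℕ} {k : ℕ}

/-- The auction of the program: the items are the vertices, with the number of vertices as the
reserve item, and the bidders are the colors, with the number of colors as the dummy. -/
def InAuction (N : ℕ → Finset ℕ) (n m : ℕ) (S : Finset ℕ) (k : ℕ) (e : Store Var Arr) : Prop :=
  IsAuction N (Finset.range n) n m S k (e.arr .owner) (e.arr .price) (e.var .bidder)

theorem startAuction_inAuction (hA : IsMatching N (Finset.range n) m A (e.arr .matching))
    (hm : e.var .color < m) (hcA : e.var .color ∉ A) :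
    InAuction N n m (insert (e.var .color) A) 0 (startAuction.run (bounds n m) e) := by
  have hitems : ∀ v < n, (startAuction.run (bounds n m) e).arr .owner v = e.arr .matching v ∧
      (startAuction.run (bounds n m) e).arr .price v = 0 := fun v hv => by
    simpa [startAuction, resetReserve, Op.run, bounds, hv.ne] using resetItems_spec hv
  have hbidder : (startAuction.run (bounds n m) e).var .bidder = e.var .color :=
    (resetItems.run_eqOff (bounds n m) e).var .color (by decide)
  rw [InAuction, hbidder]
  refine .start (hA.congr fun v hv => (hitems v (Finset.mem_range.mp hv)).1) hm.ne hcA ?_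
    (fun v hv => (hitems v (Finset.mem_range.mp hv)).2) ?_
  · simp [startAuction, resetReserve, Op.run, bounds]
  · simp [startAuction, resetReserve, Op.run, bounds]

theorem bid_inAuction (hN : IsIncidence N n m (e.arr .lists)) (hS : ∀ c ∈ S, c < m)
    (ha : InAuction N n m S k e) : InAuction N n m S (k + 1) (bid.run (bounds n m) e) := by
  by_cases hb : e.var .bidder < m
  · let e₁ := findVertex.run (bounds n m) (e.setVar .t m)
    have he₁ : e₁.EqOff findVertex.writes (e.setVar .t m) := findVertex.run_eqOff ..
    have hrun : bid.run (bounds n m) e = place.run (bounds n m) e₁ := by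
      simp [bid, Op.run, bounds, hb, e₁]
    have hbest : IsBestItem N n (e.arr .price) (e.var .bidder) n (e₁.var .best) :=
      findVertex_isBestItem (e := e.setVar .t m) hN hb
    have howner : e₁.arr .owner = e.arr .owner := he₁.arr .owner (by decide)
    have hprice : e₁.arr .price = e.arr .price := he₁.arr .price (by decide)
    have hbidder : e₁.var .bidder = e.var .bidder := he₁.var .bidder (by decide)
    have hpay := IsAuction.bid ha hb.ne (by simp)
      (hbest.accepted.imp_right fun h => ⟨hN.subset _ h, h⟩) hbest.le_reserve
      fun u hu => hbest.le u (Finset.mem_range.mp (hN.subset _ hu)) hu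
    rw [InAuction, hrun]
    simpa [place, Op.run, howner, hprice, hbidder] using hpay
  · have hbm : e.var .bidder = m := by_contra fun h => hb (hS _ (ha.hand h))
    have hrun : bid.run (bounds n m) e = e.setVar .t m := by simp [bid, Op.run, bounds, hb]
    rw [InAuction, hbm] at ha
    rw [InAuction, hrun]
    simpa [hbm] using ha.idle

theorem auction_inAuction (hN : IsIncidence N n m (e.arr .lists)) (hS : ∀ c ∈ S, c < m)
    (ha : InAuction N n m S 0 e) :
    InAuction N n m S ((n + 2) * (n + 2)) (auction.run (bounds n m) e) := by
  refine run_loop_induction (bounds n m) (b := .rounds)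
    (fun k e' => InAuction N n m S (k * (n + 2)) e') (by simpa using ha) fun k e' _ he ha' => ?_
  rw [Nat.succ_mul]
  refine run_loop_induction (bounds n m) (b := .rounds)
    (fun l e' => InAuction N n m S (k * (n + 2) + l) e') ha' fun l e'' _ he' ha'' => ?_
  refine bid_inAuction ?_ hS ha''
  have hlists : e''.arr .lists = e.arr .lists :=
    (he'.arr .lists (by decide)).trans (he.arr .lists (by decide))
  exact hlists ▸ hN

theorem commit_matching_of_sold (h : e.arr .owner n < m) :
    (commit.run (bounds n m) e).arr .matching = e.arr .matching := by
  simp [commit, Op.run, bounds, h]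

theorem copyOwners_matching {v : ℕ} (hv : v < n) :
    (copyOwners.run (bounds n m) e).arr .matching v = e.arr .owner v := by
  suffices ∀ v < n, (copyOwners.run (bounds n m) e).arr .matching v = e.arr .owner v from this v hv
  refine run_loop_induction (bounds n m) (b := .vertices)
    (fun k (e' : Store Var Arr) => ∀ v < k, e'.arr .matching v = e.arr .owner v) (by simp)
    fun k e' _ he he' v hv => ?_
  have howner : e'.arr .owner = e.arr .owner := he.arr .owner (by decide)
  rcases (Nat.le_of_lt_succ hv).lt_or_eq with hv | rfl
  · simpa [Op.run, hv.ne] using he' v hv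
  · simp [Op.run, howner]

theorem commit_matching_of_free (h : e.arr .owner n = m) {v : ℕ} (hv : v < n) :
    (commit.run (bounds n m) e).arr .matching v = e.arr .owner v := by
  simp [commit, Op.run, bounds, h, copyOwners_matching hv]

theorem commit_spec (hN : ∀ c, N c ⊆ Finset.range n) (hS : ∀ c ∈ S, c < m)
    (hk : n * (n + 2) < k) (ha : InAuction N n m S k e)
    (hA : IsMatching N (Finset.range n) m A (e.arr .matching)) :
    IsMatching N (Finset.range n) m S ((commit.run (bounds n m) e).arr .matching) ∨
      ¬ Matchable N S ∧
        IsMatching N (Finset.range n) m A ((commit.run (bounds n m) e).arr .matching) := by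
  by_cases hsold : e.arr .owner n = m
  · left
    have hbidder : e.var .bidder = m := ha.hand_eq_none (by simpa using hk)
    rw [InAuction, hbidder] at ha
    exact (ha.isMatching hsold).congr fun v hv =>
      commit_matching_of_free hsold (Finset.mem_range.mp hv)
  · right
    have howner : e.arr .owner n < m := hS _ <| Finset.mem_of_mem_erase <|
      ha.isAssignment.mapsTo ⟨Finset.mem_insert_self _ _, hsold⟩
    rw [commit_matching_of_sold howner]
    exact ⟨ha.not_matchable hN (by simp) hsold, hA⟩

theorem auction_commit_spec (hN : IsIncidence N n m (e.arr .lists))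
    (hA : IsMatching N (Finset.range n) m A (e.arr .matching)) (hAm : A ⊆ Finset.range m)
    (hm : e.var .color < m) (hcA : e.var .color ∉ A) {e' : Store Var Arr}
    (he' : (chain [startAuction, auction, commit]).run (bounds n m) e = e') :
    IsMatching N (Finset.range n) m (insert (e.var .color) A) (e'.arr .matching) ∨
      ¬ Matchable N (insert (e.var .color) A) ∧
        IsMatching N (Finset.range n) m A (e'.arr .matching) := by
  let e₁ := startAuction.run (bounds n m) e
  have he₁ : e₁.EqOff startAuction.writes e := startAuction.run_eqOff (bounds n m) e
  let e₂ := auction.run (bounds n m) e₁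
  have he₂ : e₂.EqOff auction.writes e₁ := auction.run_eqOff (bounds n m) e₁
  have hS : ∀ c ∈ insert (e.var .color) A, c < m := by
    rw [Finset.forall_mem_insert]
    exact ⟨hm, fun c hc => Finset.mem_range.mp (hAm hc)⟩
  have hlists : e₁.arr .lists = e.arr .lists := he₁.arr .lists (by decide)
  have hmatching : e₂.arr .matching = e.arr .matching :=
    (he₂.arr .matching (by decide)).trans (he₁.arr .matching (by decide))
  rw [← he']
  exact commit_spec hN.subset hS (by nlinarith)
    (auction_inAuction (hlists ▸ hN) hS (startAuction_inAuction hA hm hcA)) (hmatching ▸ hA)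

end Auction

section Selection

variable {n m : ℕ} {e : Store Var Arr}

theorem compareColor_color : (compareColor.run (bounds n m) e).var .color =
    if e.arr .keys (e.var .i) < e.arr .keys (e.var .color) then e.var .i else e.var .color := by
  by_cases h : e.arr .keys (e.var .i) < e.arr .keys (e.var .color) <;>
  simp [compareColor, Op.run, h]

theorem selectColor_color (hm : 0 < m) : (selectColor.run (bounds n m) e).var .color < m ∧
    ∀ c < m, e.arr .keys ((selectColor.run (bounds n m) e).var .color) ≤ e.arr .keys c := by
  refine run_loop_induction (bounds n m) (b := .colors) (e := e.setVar .color 0)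
    (fun k (e' : Store Var Arr) => e'.var .color < m ∧
      ∀ c < k, e.arr .keys (e'.var .color) ≤ e.arr .keys c)
    (by simpa using hm) fun k e' hk he ⟨hcolor, hmin⟩ => ?_
  have hkeys : e'.arr .keys = e.arr .keys := he.arr .keys (by decide)
  have hlast : ∀ c < k + 1, c < k ∨ c = k := fun c hc => (Nat.le_of_lt_succ hc).lt_or_eq
  simp only [compareColor_color, Store.setVar_arr, Store.setVar_var, hkeys, if_true, reduceCtorEq,
    if_false]
  split_ifs with h
  · refine ⟨hk, fun c hc => ?_⟩
    rcases hlast c hc with hc | rfl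
    exacts [h.le.trans (hmin c hc), le_rfl]
  · refine ⟨hcolor, fun c hc => ?_⟩
    rcases hlast c hc with hc | rfl
    exacts [hmin c hc, not_lt.mp h]

variable {k c cap : ℕ} {w keys : ℕ → ℕ} {P : Finset ℕ}

/-- The keys after the selection of `k` colors of least weight, which form the set `P`: the keys of
these colors have been raised to `cap`, and the other keys are still the weights. -/
structure HasSelected (w : ℕ → ℕ) (m k : ℕ) (P : Finset ℕ) (cap : ℕ) (keys : ℕ → ℕ) : Prop where
  card : P.card = k
  subset : P ⊆ Finset.range m
  le_of_notMem : ∀ c ∈ P, ∀ d < m, d ∉ P → w c ≤ w d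
  lt_cap : ∀ c < m, w c < cap
  key : ∀ c < m, keys c = if c ∈ P then cap else w c

namespace HasSelected

theorem empty (hkey : ∀ c < m, keys c = w c ∧ w c < cap) : HasSelected w m 0 ∅ cap keys where
  card := rfl
  subset := Finset.empty_subset _
  le_of_notMem := by simp
  lt_cap c hc := (hkey c hc).2
  key c hc := by simp [(hkey c hc).1]

theorem color (h : HasSelected w m k P (e.var .cap) (e.arr .keys)) (hk : k < m) :
    (selectColor.run (bounds n m) e).var .color < m ∧
      (selectColor.run (bounds n m) e).var .color ∉ P ∧
        ∀ d < m, d ∉ P → w ((selectColor.run (bounds n m) e).var .color) ≤ w d := by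
  obtain ⟨hcm, hmin⟩ := selectColor_color (n := n) (e := e) (Nat.zero_lt_of_lt hk)
  generalize (selectColor.run (bounds n m) e).var .color = c at hcm hmin ⊢
  have hmin' : ∀ d < m, d ∉ P → e.arr .keys c ≤ w d := fun d hd hdP => by
    simpa [h.key d hd, hdP] using hmin d hd
  obtain ⟨d, hd, hdP⟩ : ∃ d ∈ Finset.range m, d ∉ P :=
    Finset.exists_mem_notMem_of_card_lt_card (by simpa [h.card] using hk)
  have hcP : c ∉ P := fun hcP => by
    have := hmin' d (Finset.mem_range.mp hd) hdP
    have := h.lt_cap d (Finset.mem_range.mp hd)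
    have := h.key c hcm
    rw [if_pos hcP] at this
    omega
  refine ⟨hcm, hcP, ?_⟩
  rwa [h.key c hcm, if_neg hcP] at hmin'

theorem insert (h : HasSelected w m k P cap keys) (hcm : c < m) (hcP : c ∉ P)
    (hmin : ∀ d < m, d ∉ P → w c ≤ w d) :
    HasSelected w m (k + 1) (insert c P) cap (Function.update keys c cap) where
  card := by rw [Finset.card_insert_of_notMem hcP, h.card]
  subset := Finset.insert_subset (Finset.mem_range.mpr hcm) h.subset
  le_of_notMem d hd u hu huP := by
    rw [Finset.mem_insert, not_or] at huP
    rcases Finset.mem_insert.mp hd with rfl | hd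
    exacts [hmin u hu huP.2, h.le_of_notMem d hd u hu huP.2]
  lt_cap := h.lt_cap
  key d hd := by
    rcases eq_or_ne d c with rfl | hdc
    · simp
    · simpa [hdc] using h.key d hd

theorem eq_range (h : HasSelected w m m P cap keys) : P = Finset.range m :=
  Finset.eq_of_subset_of_card_le h.subset (by simp [h.card])

end HasSelected

end Selection

section Phase

variable {n m : ℕ} {w : ℕ → ℕ} {N : ℕ → Finset ℕ}

/-- After `k` phases, the greedy algorithm has considered `k` colors of least weight, and there is
a matching of the colors that it has accepted. -/
def GreedyState (N : ℕ → Finset ℕ) (w : ℕ → ℕ) (n m k : ℕ) (e : Store Var Arr) : Prop :=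
  ∃ P A, HasSelected w m k P (e.var .cap) (e.arr .keys) ∧ IsGreedy N w P A ∧
    IsMatching N (Finset.range n) m A (e.arr .matching)

theorem phase_greedyState {k : ℕ} {e : Store Var Arr} (hN : IsIncidence N n m (e.arr .lists))
    (hk : k < m) (h : GreedyState N w n m k e) :
    GreedyState N w n m (k + 1) (phase.run (bounds n m) e) := by
  obtain ⟨P, A, hP, hA, hf⟩ := h
  let e₁ := selectColor.run (bounds n m) e
  have he₁ : e₁.EqOff selectColor.writes e := run_eqOff ..
  let e₂ := e₁.setArr .keys (e₁.var .color) (e₁.var .cap)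
  let e₃ := (chain [startAuction, auction, commit]).run (bounds n m) e₂
  have he₃ : e₃.EqOff (chain [startAuction, auction, commit]).writes e₂ := run_eqOff ..
  have hcap : e₁.var .cap = e.var .cap := he₁.var .cap (by decide)
  have hkeys : e₁.arr .keys = e.arr .keys := he₁.arr .keys (by decide)
  have hlists : e₁.arr .lists = e.arr .lists := he₁.arr .lists (by decide)
  have hmatching : e₁.arr .matching = e.arr .matching := he₁.arr .matching (by decide)
  obtain ⟨hcm, hcP, hmin⟩ := hP.color (n := n) hk
  have hcap' : e₃.var .cap = e.var .cap := (he₃.var .cap (by decide)).trans hcap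
  have hkeys' : e₃.arr .keys = Function.update (e.arr .keys) (e₁.var .color) (e.var .cap) :=
    (he₃.arr .keys (by decide)).trans (by simp [e₂, hkeys, hcap])
  have hP' : HasSelected w m (k + 1) (insert (e₁.var .color) P) (e₃.var .cap) (e₃.arr .keys) := by
    rw [hcap', hkeys']
    exact hP.insert hcm hcP hmin
  rcases auction_commit_spec (e := e₂) (hlists ▸ hN) (hmatching ▸ hf)
    (hA.subset.trans hP.subset) hcm (fun h => hcP (hA.subset h)) rfl with hf' | ⟨hc, hf'⟩
  · exact ⟨_, _, hP', hA.accept hf'.matchable, hf'⟩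
  · exact ⟨_, _, hP', hA.reject (fun d hd => hP.le_of_notMem d hd _ hcm hcP) hc, hf'⟩

end Phase

section Output

variable {n m : ℕ} {e : Store Var Arr}

theorem checkMatching_failed : (checkMatching.run (bounds n m) e).var .failed =
    if ∃ v < n, m ≤ e.arr .matching v then 1 else 0 := by
  refine run_loop_induction (bounds n m) (b := .vertices)
    (e := (chain [op (const .failed 0), op (bound .u .colors)] : Code).run (bounds n m) e)
    (fun k (e' : Store Var Arr) =>
      e'.var .failed = if ∃ v < k, m ≤ e.arr .matching v then 1 else 0)
    (by simp [Op.run]) fun k e' _ he he' => ?_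
  have hu : e'.var .u = m := he.var .u (by decide)
  have hmatching : e'.arr .matching = e.arr .matching := he.arr .matching (by decide)
  simp only [Nat.exists_lt_succ_right]
  by_cases hk : e.arr .matching k < m
  · simp [Op.run, hu, hmatching, hk, he', hk.not_ge]
  · simp [Op.run, hu, hmatching, hk, not_lt.mp hk]

theorem printMatching_out : (printMatching.run (bounds n m) e).out =
    e.out ++ 1 :: (List.range n).map (e.arr .matching) := by
  suffices (printMatching.run (bounds n m) e).out =
    (e.out ++ [1]) ++ (List.range n).map (e.arr .matching) by simpa
  refine run_loop_induction (bounds n m) (b := .vertices)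
    (e := (chain [op (const .t 1), op (print .t)] : Code).run (bounds n m) e)
    (fun k e' => e'.out = (e.out ++ [1]) ++ (List.range k).map (e.arr .matching))
    (by simp [Op.run]) fun k e' _ he he' => ?_
  have hmatching : e'.arr .matching = e.arr .matching := he.arr .matching (by decide)
  simp [Op.run, he', hmatching, List.range_succ]

theorem output_out : (output.run (bounds n m) e).out = e.out ++
    if ∃ v < n, m ≤ e.arr .matching v then [0] else 1 :: (List.range n).map (e.arr .matching) := by
  have hfailed : (checkMatching.run (bounds n m) e).var .failed = _ := checkMatching_failed
  have he : (checkMatching.run (bounds n m) e).EqOff checkMatching.writes e := run_eqOff ..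
  have hout : (checkMatching.run (bounds n m) e).out = e.out := he.out (by decide)
  have hmatching : (checkMatching.run (bounds n m) e).arr .matching = e.arr .matching :=
    he.arr .matching (by decide)
  split_ifs at hfailed ⊢ with h
  · simp [output, Op.run, hfailed, hout]
  · simp [output, Op.run, hfailed, hout, printMatching_out, hmatching]

end Output

section Program

variable {n m : ℕ} {N : ℕ → Finset ℕ} {x : List ℕ}

theorem input_spec (hN : IsIncidence N n m fun i => x.getD (n * n + i) 0) {e : Store Var Arr}
    (he : input.run (bounds n m) (Store.init x) = e) :
    IsIncidence N n m (e.arr .lists) ∧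
      GreedyState N (fun c => x.getD (n * n + n * m + c) 0) n m 0 e ∧ e.out = [] := by
  let e₁ := skipGraph.run (bounds n m) (Store.init x)
  have hinp₁ : e₁.inp = x.drop (n * n) := skipGraph_inp ..
  let e₂ := readLists.run (bounds n m) e₁
  obtain ⟨hinp₂, hlists⟩ : e₂.inp = _ ∧ _ := readLists_spec n m e₁
  let e₃ := readWeights.run (bounds n m) e₂
  have he₃ : e₃.EqOff readWeights.writes e₂ := run_eqOff ..
  have he₄ : e.EqOff clearMatching.writes e₃ := he ▸ run_eqOff ..
  have hweights : ∀ c, e₂.inp.getD c 0 = x.getD (n * n + n * m + c) 0 := fun c => by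
    simp [hinp₂, hinp₁, Nat.add_assoc]
  refine ⟨⟨hN.subset, fun v hv c hc => ?_⟩, ⟨∅, ∅, .empty fun c hc => ?_, .empty _ _,
    .empty fun v hv => ?_⟩, ?_⟩
  · have hlists' : e.arr .lists = e₂.arr .lists :=
      (he₄.arr .lists (by decide)).trans (he₃.arr .lists (by decide))
    have hvc : v * m + c < n * m := by nlinarith
    rw [hN.mem_iff v hv c hc, hlists', hlists _ hvc, hinp₁]
    simp
  · rw [he₄.arr .keys (by decide), he₄.var .cap (by decide), ← hweights]
    exact readWeights_spec n m e₂ hc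
  · rw [← he]
    exact clearMatching_spec n m e₃ (Finset.mem_range.mp hv)
  · have hout : e.EqOff input.writes (Store.init x) := he ▸ run_eqOff ..
    exact hout.out (by decide)

theorem program_out (hN : IsIncidence N n m fun i => x.getD (n * n + i) 0) :
    ∃ A f, IsGreedy N (fun c => x.getD (n * n + n * m + c) 0) (Finset.range m) A ∧
      IsMatching N (Finset.range n) m A f ∧
      (program.run (bounds n m) (Store.init x)).out =
        if ∃ v < n, m ≤ f v then [0] else 1 :: (List.range n).map f := by
  obtain ⟨hN', hgreedy, hout⟩ := input_spec hN rfl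
  set e := input.run (bounds n m) (Store.init x)
  let e' := (loop .k .colors phase).run (bounds n m) e
  have he' : e'.EqOff (loop .k .colors phase).writes e := run_eqOff ..
  have hgreedy' : GreedyState N (fun c => x.getD (n * n + n * m + c) 0) n m m e' := by
    refine run_loop_induction (bounds n m) (b := .colors) (GreedyState N _ n m) hgreedy
      fun k e'' hk he'' hgreedy'' => ?_
    have hlists : e''.arr .lists = e.arr .lists := he''.arr .lists (by decide)
    exact phase_greedyState (hlists ▸ hN') hk hgreedy''
  obtain ⟨P, A, hP, hA, hf⟩ := hgreedy'
  refine ⟨A, e'.arr .matching, hP.eq_range ▸ hA, hf, ?_⟩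
  have hout' : e'.out = [] := (he'.out (by decide)).trans hout
  refine output_out.trans ?_
  rw [hout', List.nil_append]

end Program

/-! ### Running time of the program -/

/-- The registers of the compiled program. -/
def layout : Layout Var Arr Bound where
  var := ⟨Var.ctorIdx, fun x y h => by cases x <;> cases y <;> first | rfl | cases h⟩
  arr := ⟨fun k => match k with
      | .lists => 0
      | .keys => 1
      | .matching => 2
      | .owner => 3
      | .price => 4,
    fun k l h => by cases k <;> cases l <;> first | rfl | cases h⟩
  bound
    | .vertices => 0
    | .colors => 1
    | .rounds => 2

/-- Read the numbers of vertices and colors, and compute the number of rounds. -/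
def readBounds : List Instr :=
  [.read (layout.reg (.guard 0)), .read (layout.reg (.guard 1)), .const (layout.reg .aux) 2,
    .add (layout.reg (.guard 2)) (layout.reg (.guard 0)) (layout.reg .aux)]

/-- The compiled form of a piece of code that starts after the numbers of vertices and colors. -/
def compile (p : Code) : Prog := .seq (block readBounds) (layout.code 3 p)

theorem hasBounds_readBounds (n m : ℕ) (x : List ℕ) :
    layout.HasBounds (bounds n m) (blockEffect readBounds (RAM.init (n :: m :: x))) := by
  rintro (- | - | -) <;> simp [readBounds, blockEffect, Instr.effect, RAM.init, layout, bounds]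

theorem store_readBounds (n m : ℕ) (x : List ℕ) :
    layout.store (blockEffect readBounds (RAM.init (n :: m :: x))) = Store.init x := by
  simp [readBounds, blockEffect, Instr.effect, RAM.init, Layout.store, Store.init]

theorem blockCost_readBounds_le (n m : ℕ) (x : List ℕ) :
    blockCost readBounds (RAM.init (n :: m :: x)) ≤ 2 * inputSize (n :: m :: x) + 7 := by
  have : len 2 = 3 := rfl
  simp only [readBounds, blockCost, Instr.effect, Instr.cost, RAM.init, inputSize, List.headD_cons,
    List.tail_cons, List.map_cons, List.sum_cons, Function.update_apply, Layout.reg_inj,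
    Cell.guard.injEq, reduceCtorEq, if_true, if_false, zero_ne_one]
  omega

theorem exists_polynomial_haltsWithin_compile (p : Code) :
    ∃ b : Polynomial ℕ, ∀ (n m : ℕ) (x : List ℕ), n ≤ x.length → m ≤ x.length →
      HaltsWithin (compile p) (RAM.init (n :: m :: x)) (b.eval (inputSize (n :: m :: x)))
        fun s => s.out = (p.run (bounds n m) (Store.init x)).out := by
  refine ⟨2 * .X + 7 + p.cost.comp (.X + 2) * (.X + (2 + p.growth.comp (.X + 2)) + 6),
    fun n m x hn hm => ?_⟩
  set N := inputSize (n :: m :: x)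
  have hlen : x.length + 2 ≤ N := length_le_inputSize (n :: m :: x)
  have hN : N < 2 ^ N := Nat.lt_two_pow_self
  have hbounds : ∀ b, bounds n m b ≤ N + 2 := by
    rintro (- | - | -) <;> simp only [bounds] <;> omega
  have hd : ∀ b, layout.bound b < 3 := by
    rintro (- | - | -) <;> decide
  have hbounded : (Store.init x : Store Var Arr).Bounded (2 ^ N + 2) :=
    ⟨fun _ => Nat.zero_le _, fun _ _ => Nat.zero_le _, fun a ha =>
      (le_two_pow_inputSize (.tail _ (.tail _ ha))).trans (Nat.le_add_right _ 2)⟩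
  simp only [Polynomial.eval_add, Polynomial.eval_mul, Polynomial.eval_comp, Polynomial.eval_X,
    Polynomial.eval_ofNat]
  refine (haltsWithin_block (blockCost_readBounds_le n m x) rfl).seq fun s hs => ?_
  have hstore : layout.store s = Store.init x := hs ▸ store_readBounds n m x
  refine (layout.implements_code hd hbounds (by omega) p s (hs ▸ hasBounds_readBounds n m x)
    (hstore ▸ hbounded)).mono ?_ fun s' hs' => ?_
  · rw [Nat.add_assoc (2 ^ N)]
    exact Nat.mul_le_mul_left _ (unitCost_two_pow_le _ _)
  · exact congrArg Store.out (hs'.1.trans (congrArg _ hstore))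

/-! ### Instances and their encodings -/

/-- The entries of a matrix, row by row. -/
def rowMajor {n m : ℕ} (g : Fin n → Fin m → ℕ) : List ℕ :=
  (List.finRange n).flatMap fun u => (List.finRange m).map (g u)

section RowMajor

variable {n m : ℕ} (g : Fin n → Fin m → ℕ)

theorem length_rowMajor : (rowMajor g).length = n * m := by simp [rowMajor]

theorem mul_add_eq_val_finProdFinEquiv (u : Fin n) (v : Fin m) :
    (u * m + v : ℕ) = finProdFinEquiv (u, v) := by
  simp [mul_comm, add_comm]

theorem rowMajor_eq_ofFn :
    rowMajor g = List.ofFn fun k => Function.uncurry g (finProdFinEquiv.symm k) := by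
  rw [List.ofFn_mul, rowMajor, List.flatMap_def, ← List.ofFn_eq_map]
  simp only [← List.ofFn_eq_map, mul_add_eq_val_finProdFinEquiv, Fin.eta, Equiv.symm_apply_apply,
    Function.uncurry_apply_pair]

theorem getD_rowMajor (u : Fin n) (v : Fin m) : (rowMajor g).getD (u * m + v) 0 = g u v := by
  rw [mul_add_eq_val_finProdFinEquiv, rowMajor_eq_ofFn]
  simp [-finProdFinEquiv_apply_val, -finProdFinEquiv_symm_apply]

end RowMajor

open Classical in
/-- The part of the input after the numbers of vertices and colors. -/
noncomputable def encodeTail (I : WLCP) : List ℕ :=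
  rowMajor (fun u v => if I.G.Adj u v then 1 else 0) ++
    rowMajor (fun v j => if j ∈ I.L v then 1 else 0) ++ (List.finRange I.m).map I.w

/-- The numbers of the vertices whose lists contain the color number `c`. -/
def neighbors (I : WLCP) (c : ℕ) : Finset ℕ :=
  ({v | ∃ j ∈ I.L v, (j : ℕ) = c} : Finset (Fin I.n)).map Fin.valEmbedding

/-- The numbers of the active colors. -/
def colorNumbers (I : WLCP) (f : Fin I.n → Fin I.m) : Finset ℕ :=
  (I.activeColors f).map Fin.valEmbedding

section Encoding

variable (I : WLCP)

theorem encode_eq : I.encode = I.n :: I.m :: I.encodeTail := rfl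

theorem length_encodeTail : I.encodeTail.length = I.n * I.n + I.n * I.m + I.m := by
  simp [encodeTail, length_rowMajor, Nat.add_assoc]

theorem getD_encodeTail_list (v : Fin I.n) (c : Fin I.m) :
    I.encodeTail.getD (I.n * I.n + (v * I.m + c)) 0 = if c ∈ I.L v then 1 else 0 := by
  have hvc : (v * I.m + c : ℕ) < I.n * I.m := by
    rw [mul_add_eq_val_finProdFinEquiv]
    exact Fin.is_lt _
  rw [encodeTail, List.append_assoc,
    List.getD_append_right _ _ _ _ (by simp [length_rowMajor]), length_rowMajor,
    Nat.add_sub_cancel_left, List.getD_append _ _ _ _ (by simpa [length_rowMajor] using hvc),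
    getD_rowMajor]

theorem getD_encodeTail_weight (c : Fin I.m) :
    I.encodeTail.getD (I.n * I.n + I.n * I.m + c) 0 = I.w c := by
  rw [encodeTail, List.getD_append_right _ _ _ _ (by simp [length_rowMajor])]
  simp [length_rowMajor]

variable {I}

theorem val_mem_neighbors {v : Fin I.n} {c : Fin I.m} : (v : ℕ) ∈ I.neighbors c ↔ c ∈ I.L v := by
  simp [neighbors, Fin.val_inj]

variable (I) in
theorem isIncidence_neighbors :
    IsIncidence I.neighbors I.n I.m fun i => I.encodeTail.getD (I.n * I.n + i) 0 where
  subset c v hv := by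
    obtain ⟨u, -, rfl⟩ := Finset.mem_map.mp hv
    exact Finset.mem_range.mpr u.2
  mem_iff v hv c hc := by
    rw [getD_encodeTail_list I ⟨v, hv⟩ ⟨c, hc⟩]
    refine (val_mem_neighbors (v := ⟨v, hv⟩) (c := ⟨c, hc⟩)).trans ?_
    split_ifs with h <;> simp [h]

variable {f : Fin I.n → Fin I.m}

theorem mem_colorNumbers {c : ℕ} : c ∈ I.colorNumbers f ↔ ∃ v, (f v : ℕ) = c := by
  simp [colorNumbers, activeColors]

variable (I f) in
theorem colorNumbers_subset_range : I.colorNumbers f ⊆ Finset.range I.m := by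
  intro c hc
  obtain ⟨v, rfl⟩ := mem_colorNumbers.mp hc
  exact Finset.mem_range.mpr (f v).2

theorem card_colorNumbers (hf : Function.Injective f) : (I.colorNumbers f).card = I.n := by
  rw [colorNumbers, Finset.card_map, activeColors, Finset.card_image_of_injective _ hf,
    Finset.card_fin]

variable (I f) in
theorem weight_eq_sum_colorNumbers :
    I.weight f = ∑ c ∈ I.colorNumbers f, I.encodeTail.getD (I.n * I.n + I.n * I.m + c) 0 := by
  rw [colorNumbers, Finset.sum_map, weight]
  exact Finset.sum_congr rfl fun c _ => (I.getD_encodeTail_weight c).symm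

end Encoding

/-! ### List colorings and matchings -/

section Coloring

variable {I : WLCP} {f : Fin I.n → Fin I.m}

theorem IsListColoring.injective (hf : I.IsListColoring f)
    (hI : ∀ j, I.colorGraph j = ⊤) : Function.Injective f := by
  intro u v huv
  by_contra hne
  have hadj : (I.colorGraph (f u)).Adj ⟨u, hf.2 u⟩ ⟨v, huv ▸ hf.2 v⟩ := by
    rw [hI]
    exact fun h => hne (congrArg Subtype.val h)
  exact hf.1 u v hadj huv

theorem isListColoring_of_injective (hf : Function.Injective f) (hL : ∀ v, f v ∈ I.L v) :
    I.IsListColoring f :=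
  ⟨fun _ _ huv => hf.ne huv.ne, hL⟩

theorem IsListColoring.matchable_colorNumbers (hf : I.IsListColoring f) :
    Matchable I.neighbors (I.colorNumbers f) := by
  choose v hv using fun c : I.colorNumbers f => mem_colorNumbers.mp c.2
  refine ⟨fun c => v c, fun c d hcd => Subtype.ext ?_, fun c => ?_⟩
  · rw [← hv c, ← hv d, Fin.ext hcd]
  · rw [← hv c, val_mem_neighbors]
    exact hf.2 (v c)

variable {A : Finset ℕ} {g : ℕ → ℕ} {w : ℕ → ℕ}

theorem not_isListColoring_of_unmatched
    (hinj : Function.Injective f) (hA : IsGreedy I.neighbors w (Finset.range I.m) A)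
    (hg : IsMatching I.neighbors (Finset.range I.n) I.m A g) {v : ℕ} (hv : v < I.n)
    (hgv : g v = I.m) : ¬ I.IsListColoring f := by
  intro hf
  have hle : I.n ≤ A.card := by
    rw [← card_colorNumbers hinj]
    exact hA.card_le hf.matchable_colorNumbers (I.colorNumbers_subset_range f)
  have hlt := hg.card_lt (Finset.mem_range.mpr hv) hgv
  rw [Finset.card_range] at hlt
  omega

section Matched

variable (hg : IsMatching I.neighbors (Finset.range I.n) I.m A g) (hfg : ∀ v, (f v : ℕ) = g v)

include hg hfg

theorem injective_of_isMatching : Function.Injective f := by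
  have hmem : ∀ v : Fin I.n, (v : ℕ) ∈ {v | v ∈ Finset.range I.n ∧ g v ≠ I.m} := fun v =>
    ⟨Finset.mem_range.mpr v.2, hfg v ▸ (f v).2.ne⟩
  intro u v huv
  refine Fin.ext (hg.isAssignment.injOn (hmem u) (hmem v) ?_)
  rw [← hfg, ← hfg, huv]

theorem isListColoring_of_isMatching : I.IsListColoring f := by
  refine isListColoring_of_injective (injective_of_isMatching hg hfg) fun v => ?_
  rw [← val_mem_neighbors, hfg]
  exact hg.mem v (Finset.mem_range.mpr v.2) (hfg v ▸ (f v).2.ne)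

theorem colorNumbers_eq_of_isMatching : I.colorNumbers f = A := by
  ext c
  rw [mem_colorNumbers]
  constructor
  · rintro ⟨v, rfl⟩
    rw [hfg]
    exact hg.isAssignment.mapsTo ⟨Finset.mem_range.mpr v.2, hfg v ▸ (f v).2.ne⟩
  · intro hc
    obtain ⟨v, ⟨hv, -⟩, rfl⟩ := hg.isAssignment.surjOn hc
    exact ⟨⟨v, Finset.mem_range.mp hv⟩, hfg _⟩

theorem isOptimal_of_isMatching
    (hI : ∀ f', I.IsListColoring f' → Function.Injective f')
    (hA : IsGreedy I.neighbors (fun c => I.encodeTail.getD (I.n * I.n + I.n * I.m + c) 0)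
      (Finset.range I.m) A) : I.IsOptimal f := by
  refine ⟨isListColoring_of_isMatching hg hfg, fun f' hf' => ?_⟩
  rw [weight_eq_sum_colorNumbers, weight_eq_sum_colorNumbers, colorNumbers_eq_of_isMatching hg hfg]
  refine hA.sum_le hf'.matchable_colorNumbers (I.colorNumbers_subset_range f') ?_
  rw [← colorNumbers_eq_of_isMatching hg hfg, card_colorNumbers (hI f' hf'),
    card_colorNumbers (injective_of_isMatching hg hfg)]

end Matched

theorem isAnswer_program (hI : ∀ f, I.IsListColoring f → Function.Injective f) :
    I.IsAnswer (program.run (bounds I.n I.m) (Store.init I.encodeTail)).out := by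
  obtain ⟨A, g, hA, hg, hout⟩ := program_out I.isIncidence_neighbors
  rw [hout]
  split_ifs with hunmatched
  · obtain ⟨v, hv, hgv⟩ := hunmatched
    have hgv' : g v = I.m := by
      by_contra hne
      have := hA.subset (hg.isAssignment.mapsTo ⟨Finset.mem_range.mpr hv, hne⟩)
      exact hgv.not_gt (Finset.mem_range.mp this)
    exact Or.inl ⟨fun ⟨f, hf⟩ => not_isListColoring_of_unmatched (hI f hf) hA hg hv hgv' hf, rfl⟩
  · push Not at hunmatched
    refine Or.inr ⟨fun v => ⟨g v, hunmatched v v.2⟩,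
      isOptimal_of_isMatching hg (fun _ => rfl) hI hA, ?_⟩
    rw [List.ofFn_eq_map, ← List.map_coe_finRange_eq_range, List.map_map]
    rfl

end Coloring

end WLCP

theorem mainTheorem1_general :
    RAM.PolyTimeSolvableOn WLCP.encode WLCP.IsAnswer
      {I : WLCP | ∀ f, I.IsListColoring f → Function.Injective f} := by
  obtain ⟨b, hb⟩ := WLCP.exists_polynomial_haltsWithin_compile WLCP.program
  refine ⟨WLCP.compile WLCP.program, b, fun I hI => ?_⟩
  have hlen := I.length_encodeTail
  have hn := Nat.le_mul_self I.n
  obtain ⟨t, s, hexec, ht, hout⟩ := hb I.n I.m I.encodeTail (by omega) (by omega)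
  rw [WLCP.encode_eq]
  exact ⟨t, s, hexec, ht, hout ▸ WLCP.isAnswer_program hI⟩

theorem mainTheorem1 :
    RAM.PolyTimeSolvableOn WLCP.encode WLCP.IsAnswer
      {I : WLCP | ∀ j : Fin I.m, I.colorGraph j = ⊤} := by
  exact mainTheorem1_general.mono fun _ hI _ hf => hf.injective hI
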